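/- **Setting.** Let $J=(J(s))_{s\ge 0}$ be a càdlàg, irreducible continuous-time Markov chain with finite state space $\mathcal E=\{1,\dots,d\}$, generator matrix $Q$ and arbitrary initial distribution, and let $\lambda,\kappa,\mu:\mathcal E\to[0,\infty)$. For $n\in\mathbb N$ consider the infinite-server queue modulated by $J$ with arrival rate $n\lambda$ (the chain $J$ is not scaled), which is empty at time $0$. Let $\bar\tau_1<\bar\tau_2<\dots$ be the jump times of a standard Poisson process and $\bar Z_1,\bar Z_2,\dots$ i.i.d. standard exponential variables, where the Poisson process, the sequence $(\bar Z_k)$ and $J$ are independent. Job $k$ arrives at time $$\tau_k=\inf\Big\{s\ge 0: \int_0^s n\lambda(J(r))\,dr\ge\bar\tau_k\Big\}\qquad(\inf\emptyset=\infty)$$ and has service requirement $Z_k=\bar Z_k/\kappa(J(\tau_k))$ (with $Z_k=\infty$ if $\kappa(J(\tau_k))=0$). It is processed at rate $\mu(J(r))$ at time $r$. For fixed $t\ge 0$ the number of jobs in the system at time $t$ is $$M_n(t)=\#\Big\{k:\ \tau_k\le t,\ Z_k>\int_{\tau_k}^t\mu(J(r))\,dr\Big\}.$$ For a càdlàg path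 $g:[0,\infty)\to\mathcal E$ put $$\phi_t(g)=\int_0^t\lambda(g(s))\,e^{-\kappa(g(s))\int_s^t\mu(g(r))\,dr}\,ds .$$ The set of attainable parameters $\mathcal R(t)$ consists of all $\gamma\ge 0$ with $\mathbb P(|\phi_t(J)-\gamma|<\epsilon)>0$ for every $\epsilon>0$. For $\gamma\ge0$ let $\ell(\gamma;\cdot)$ be the Fenchel–Legendre transform of the cumulant generating function of the Poisson distribution with parameter $\gamma$, i.e. $\ell(\gamma;a)=\infty$ for $a<0$, $\ell(\gamma;0)=\gamma$, and $\ell(\gamma;a)=\gamma-a+a\log(a/\gamma)$ for $a>0$ (read as $\infty$ if $\gamma=0$). A sequence of probability measures $(\tau_n)$ on $\mathbb R$ satisfies an LDP with rate function $\rho:\mathbb R\to[0,\infty]$ if $\rho$ is lower semicontinuous, $\limsup_n\frac1n\log\tau_n(F)\le-\inf_F\rho$ for all closed $F$ and $\liminf_n\frac1n\log\tau_n(G)\ge-\inf_G\rho$ for all open $G$. **Statement.** Let $a_-=\inf_g\phi_t(g)$ and $a_+=\sup_g\phi_t(g)$, over all càdlàg paths $g:[0,\infty)\to\mathcal E$.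 Then $0\le a_-\le a_+<\infty$ and $$\mathcal R(t)=[a_-,a_+].$$ The constant sequence of laws of $\phi_t(J)$ satisfies an LDP with some rate function $\psi$, and $\frac1nM_n(t)$ satisfies a (full) LDP with rate function $I(a)=\inf_{\gamma\in\mathcal R(t)}[\ell(\gamma;a)+\psi(\gamma)]$, which is given by $$I(a)=\begin{cases}\infty & a<0,\\ \ell(a_-;a) & 0\le a\le a_-,\\ 0 & a_-\le a\le a_+,\\ \ell(a_+;a) & a\ge a_+.\end{cases}$$ -/

import Mathlib

open Filter Topology MeasureTheory ProbabilityTheory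
open scoped NNReal ENNReal

/-! ### Large deviations principles -/

/-- `τ` satisfies a large deviations principle (at speed `n`) with rate function `ρ`, where `ρ` is
lower semicontinuous with values in `[0, ∞]`; it need not have compact level sets. Here
`ENNReal.log 0 = ⊥` and an infimum over the empty set is `⊤`. -/
structure SatisfiesLDP {X : Type*} [TopologicalSpace X] [MeasurableSpace X]
    (τ : ℕ → Measure X) (ρ : X → ℝ≥0∞) : Prop where
  lowerSemicontinuous : LowerSemicontinuous ρ
  upper_bound : ∀ F : Set X, IsClosed F →
    limsup (fun n : ℕ => ENNReal.log (τ n F) / (n : EReal)) atTop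
      ≤ -((⨅ a ∈ F, ρ a : ℝ≥0∞) : EReal)
  lower_bound : ∀ G : Set X, IsOpen G →
    -((⨅ a ∈ G, ρ a : ℝ≥0∞) : EReal)
      ≤ liminf (fun n : ℕ => ENNReal.log (τ n G) / (n : EReal)) atTop

/-- The attainable parameters of a sequence `ν` of laws of (normalized) random Poisson
parameters. -/
def attainableSet (ν : ℕ → Measure ℝ) : Set ℝ :=
  {γ | 0 ≤ γ ∧ ∀ ε : ℝ, 0 < ε → ∃ N : ℕ, ∀ n : ℕ, N ≤ n → 0 < ν n (Metric.ball γ ε)}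

/-- `ℓ(γ ; a)` for `γ ≥ 0`: the Fenchel-Legendre transform at `a` of the cumulant generating
function `θ ↦ γ (e ^ θ - 1)` of the Poisson distribution with parameter `γ`
(see `poissonRate_eq_legendre`). -/
noncomputable def poissonRate (γ a : ℝ) : ℝ≥0∞ :=
  if a < 0 then ⊤
  else if a = 0 then ENNReal.ofReal γ
  else if γ = 0 then ⊤
  else ENNReal.ofReal (γ - a + a * Real.log (a / γ))

theorem poissonRate_eq_legendre {γ : ℝ} (hγ : 0 ≤ γ) (a : ℝ) :
    (poissonRate γ a : EReal) = ⨆ θ : ℝ, ((θ * a - γ * (Real.exp θ - 1) : ℝ) : EReal) := by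
  unfold poissonRate
  split_ifs with h1 h2 h3
  · symm
    rw [EReal.coe_ennreal_top, EReal.eq_top_iff_forall_lt]
    intro b
    refine lt_of_lt_of_le ?_ (le_iSup _ ((|b| + 1) / a))
    rw [EReal.coe_lt_coe_iff, div_mul_cancel₀ _ h1.ne]
    have hθ : (|b| + 1) / a ≤ 0 := div_nonpos_of_nonneg_of_nonpos (by positivity) h1.le
    have he := Real.exp_le_one_iff.2 hθ
    nlinarith [le_abs_self b]
  · subst h2
    rw [EReal.coe_ennreal_ofReal, max_eq_left hγ]
    apply le_antisymm
    · have ht : Tendsto (fun θ : ℝ => ((θ * 0 - γ * (Real.exp θ - 1) : ℝ) : EReal)) atBot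
          (𝓝 (γ : EReal)) := by
        refine (continuous_coe_real_ereal.tendsto γ).comp ?_
        have := (Real.tendsto_exp_atBot.sub_const 1).const_mul (-γ)
        simpa using this
      exact le_of_tendsto' ht fun θ =>
        le_iSup (fun θ : ℝ => ((θ * 0 - γ * (Real.exp θ - 1) : ℝ) : EReal)) θ
    · refine iSup_le fun θ => ?_
      rw [EReal.coe_le_coe_iff]
      nlinarith [Real.exp_pos θ]
  · symm
    have ha : 0 < a := lt_of_le_of_ne (not_lt.1 h1) (Ne.symm h2)
    rw [EReal.coe_ennreal_top, EReal.eq_top_iff_forall_lt]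
    intro b
    refine lt_of_lt_of_le ?_ (le_iSup _ ((|b| + 1) / a))
    rw [EReal.coe_lt_coe_iff, div_mul_cancel₀ _ ha.ne', h3]
    linarith [le_abs_self b]
  · have ha : 0 < a := lt_of_le_of_ne (not_lt.1 h1) (Ne.symm h2)
    have hg : 0 < γ := lt_of_le_of_ne hγ (Ne.symm h3)
    have key : ∀ θ : ℝ, θ * a - γ * (Real.exp θ - 1) ≤ γ - a + a * Real.log (a / γ) := by
      intro θ
      have h := Real.add_one_le_exp (θ - Real.log (a / γ))
      rw [Real.exp_sub, Real.exp_log (by positivity)] at h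
      have h' := mul_le_mul_of_nonneg_left h ha.le
      have e : a * (Real.exp θ / (a / γ)) = γ * Real.exp θ := by field_simp
      rw [e] at h'
      linarith
    have h0 : 0 ≤ γ - a + a * Real.log (a / γ) := by simpa using key 0
    rw [EReal.coe_ennreal_ofReal, max_eq_left h0]
    apply le_antisymm
    · refine le_trans ?_ (le_iSup _ (Real.log (a / γ)))
      rw [EReal.coe_le_coe_iff, Real.exp_log (by positivity)]
      have e : γ * (a / γ - 1) = a - γ := by field_simp
      rw [e]
      linarith
    · exact iSup_le fun θ => EReal.coe_le_coe_iff.2 (key θ)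

/-- The rate function `I(a) = inf_{γ ∈ R} [ℓ(γ ; a) + ψ(γ)]`. -/
noncomputable def mixedPoissonRate (R : Set ℝ) (ψ : ℝ → ℝ≥0∞) (a : ℝ) : ℝ≥0∞ :=
  ⨅ γ ∈ R, (poissonRate γ a + ψ γ)

/-! ### Paths and the random Poisson parameter -/

/-- Right-continuous paths `[0, ∞) → E` with left limits. -/
def IsCadlagPath {E : Type*} [TopologicalSpace E] (f : ℝ≥0 → E) : Prop :=
  (∀ s : ℝ≥0, ContinuousWithinAt f (Set.Ici s) s) ∧
    ∀ s : ℝ≥0, 0 < s → ∃ l : E, Tendsto f (𝓝[<] s) (𝓝 l)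

/-- `∫_u^v g(f(r)) dr` for `0 ≤ u ≤ v`, along a path `f` indexed by `[0, ∞)`. -/
noncomputable def pathIntegral {E : Type*} (g : E → ℝ≥0) (f : ℝ≥0 → E) (u v : ℝ≥0) : ℝ :=
  ∫ r in (u : ℝ)..(v : ℝ), (g (f r.toNNReal) : ℝ)

/-- `φ_t(f) = ∫_0^t λ(f(s)) exp(-κ(f(s)) ∫_s^t μ(f(r)) dr) ds`. -/
noncomputable def phi {E : Type*} (lam kap mu : E → ℝ≥0) (t : ℝ≥0) (f : ℝ≥0 → E) : ℝ :=
  ∫ s in (0 : ℝ)..(t : ℝ), (lam (f s.toNNReal) : ℝ) *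
    Real.exp (-(kap (f s.toNNReal) : ℝ) * pathIntegral mu f s.toNNReal t)

/-! ### The modulated infinite-server queue

Jobs are numbered `0, 1, 2, …`. The standard Poisson process driving the arrivals is given by its
interarrival times `σ 0, σ 1, …` and the job `k` carries a mark `z k`, its service requirement
before modulation. The following are defined for one realization of `σ`, `z` and the background
path `f`. -/

/-- The `k`-th jump time of the driving standard Poisson process. -/
def baseArrival (σ : ℕ → ℝ) (k : ℕ) : ℝ := ∑ i ∈ Finset.range (k + 1), σ i

/-- Arrival time of job `k`, i.e. the `k`-th jump time of the driving process run with the clock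
`Λ(s) = ∫_0^s λ(f(r)) dr`: the first `s` with `Λ(s) ≥ baseArrival σ k`, and `∞` if there is
none. -/
noncomputable def arrivalTime {E : Type*} (lam : E → ℝ≥0) (f : ℝ≥0 → E) (σ : ℕ → ℝ) (k : ℕ) :
    ℝ≥0∞ :=
  ⨅ (s : ℝ≥0) (_ : baseArrival σ k ≤ pathIntegral lam f 0 s), (s : ℝ≥0∞)

/-- Service requirement of a job with mark `z` arriving while the background is in state `x`:
`z / κ(x)`, or `∞` if `κ(x) = 0`. -/
noncomputable def serviceRequirement {E : Type*} (kap : E → ℝ≥0) (x : E) (z : ℝ) : ℝ≥0∞ :=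
  if 0 < kap x then ENNReal.ofReal (z / kap x) else ⊤

/-- The jobs present at time `t`: those which have arrived by time `t` and whose service requirement
exceeds the work `∫_{[τ_k, t)} μ(f(r)) dr` done on them up to time `t`. -/
def jobsPresent {E : Type*} (lam kap mu : E → ℝ≥0) (f : ℝ≥0 → E) (σ z : ℕ → ℝ) (t : ℝ≥0) :
    Set ℕ :=
  {k | arrivalTime lam f σ k ≤ t ∧
    ¬ serviceRequirement kap (f (arrivalTime lam f σ k).toNNReal) (z k)
      ≤ ENNReal.ofReal (pathIntegral mu f (arrivalTime lam f σ k).toNNReal t)}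

/-- `M(t)`, the number of jobs present at time `t` (almost surely finite; the value on the
exceptional null set is immaterial). -/
noncomputable def numJobs {E : Type*} (lam kap mu : E → ℝ≥0) (f : ℝ≥0 → E) (σ z : ℕ → ℝ)
    (t : ℝ≥0) : ℕ :=
  (jobsPresent lam kap mu f σ z t).ncard

/-- The driving randomness of the queue: the interarrival times `σ` of a standard Poisson process
and the marks `z` are independent standard exponential variables, and together they are
independent of the background process `J`. -/
structure IsQueueDriver {Ω E : Type*} [MeasurableSpace Ω] [MeasurableSpace E]
    (P : Measure Ω) (J : ℝ≥0 → Ω → E) (σ z : ℕ → Ω → ℝ) : Prop where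
  law_interarrival : ∀ k, HasLaw (σ k) (expMeasure 1) P
  law_mark : ∀ k, HasLaw (z k) (expMeasure 1) P
  indep_driver : iIndepFun (Sum.elim σ z) P
  indep_background : IndepFun (fun ω s => J s ω) (fun ω => (fun k => σ k ω, fun k => z k ω)) P

/-! ### Irreducible continuous-time Markov chains on a finite set -/

/-- `Q` is a generator (transition rate) matrix. -/
structure IsGeneratorMatrix {E : Type*} [Fintype E] (Q : Matrix E E ℝ) : Prop where
  offDiag_nonneg : ∀ i j, i ≠ j → 0 ≤ Q i j
  row_sum : ∀ i, ∑ j, Q i j = 0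

/-- Any state can be reached from any other one by finitely many transitions of positive rate. -/
def IsIrreducibleGenerator {E : Type*} (Q : Matrix E E ℝ) : Prop :=
  ∀ i j, Relation.ReflTransGen (fun x y => x ≠ y ∧ 0 < Q x y) i j

/-- `J` is a càdlàg continuous-time Markov chain with generator `Q` (and arbitrary initial
distribution): for `s ≤ u`, conditionally on the history up to time `s`, the state at time `u` has
law `exp((u - s) Q) (J s, ·)`. -/
structure IsMarkovChain {Ω E : Type*} [MeasurableSpace Ω] [Fintype E] [DecidableEq E]
    [TopologicalSpace E] [MeasurableSpace E]
    (P : Measure Ω) (Q : Matrix E E ℝ) (J : ℝ≥0 → Ω → E) : Prop where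
  measurable : ∀ s, Measurable (J s)
  cadlag : ∀ ω, IsCadlagPath (fun s => J s ω)
  markov : ∀ s u : ℝ≥0, s ≤ u → ∀ A : Set Ω,
    MeasurableSet[⨆ (r : ℝ≥0) (_ : r ≤ s), MeasurableSpace.comap (J r) inferInstance] A →
    ∀ i j : E, P (A ∩ J s ⁻¹' {i} ∩ J u ⁻¹' {j})
      = P (A ∩ J s ⁻¹' {i}) * ENNReal.ofReal (NormedSpace.exp (((u : ℝ) - (s : ℝ)) • Q) i j)

/-!
Given the path of `J`, the count `M_n(t)` is Poisson with parameter `n φ_t(J)`: clock time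
`u = ∫_0^s nλ(J(r)) dr` turns the arrivals into a standard Poisson process, a job arriving at clock
time `u` survives until `t` exactly when its mark exceeds a deterministic threshold depending on
`u`, and independently thinning a Poisson process leaves a Poisson number of points. So `M_n(t) / n`
is a mixture of the laws of `N / n`, `N` Poisson with parameter `n γ`, in which the law of `γ` does
not depend on `n`.

For a mixing law with support `[p, q]`, Chernoff's inequality for the parameters `p` and `q` bounds
the probability of deviations below `p` and above `q`, and Stirling's formula shows that mixing
parameters near `p` and `q` attain these bounds; nothing on `[p, q]` is exponentially unlikely. A
constant sequence of laws has rate function `0` on the support and `∞` off it.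

The support of the law of `φ_t(J)` is all of `[a_-, a_+]`. Irreducibility makes every transition
probability over a positive time positive, so `J` shadows any prescribed càdlàg path outside a set
of times of small measure with positive probability, and `φ_t` is continuous for this mode of
convergence. Moreover the values of `φ_t` form an interval, because following one path up to time
`θ` and another one afterwards interpolates continuously between the two.
-/

/-! ### Exponential bounds and large deviations principles -/

theorem log_ofReal_mul_exp_div {C : ℝ} (hC : 0 < C) (c : ℝ) (n : ℕ) :
    ENNReal.log (ENNReal.ofReal (C * Real.exp (-(n * c)))) / (n : EReal)
      = (((Real.log C - n * c) / n : ℝ) : EReal) := by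
  rw [ENNReal.log_ofReal_of_pos (by positivity), Real.log_mul hC.ne' (Real.exp_pos _).ne',
    Real.log_exp, EReal.coe_div, EReal.coe_natCast, sub_eq_add_neg]

theorem tendsto_sub_mul_div_atTop (b c : ℝ) :
    Tendsto (fun n : ℕ => (((b - n * c) / n : ℝ) : EReal)) atTop (𝓝 ((-c : ℝ) : EReal)) := by
  refine (continuous_coe_real_ereal.tendsto _).comp ?_
  have h : Tendsto (fun n : ℕ => b / n - c) atTop (𝓝 (0 - c)) :=
    (tendsto_const_div_atTop_nhds_zero_nat _).sub_const c
  rw [zero_sub] at h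
  refine h.congr' ?_
  filter_upwards [eventually_gt_atTop 0] with n hn
  field_simp

theorem limsup_log_div_le {u : ℕ → ℝ≥0∞} {C c : ℝ} (hC : 0 < C)
    (h : ∀ᶠ n : ℕ in atTop, u n ≤ ENNReal.ofReal (C * Real.exp (-(n * c)))) :
    limsup (fun n : ℕ => ENNReal.log (u n) / (n : EReal)) atTop ≤ ((-c : ℝ) : EReal) := by
  rw [← (tendsto_sub_mul_div_atTop (Real.log C) c).limsup_eq]
  refine limsup_le_limsup ?_
  filter_upwards [h] with n hn
  rw [← log_ofReal_mul_exp_div hC]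
  exact EReal.div_le_div_right_of_nonneg (by positivity) (ENNReal.log_monotone hn)

theorem le_liminf_log_div {u : ℕ → ℝ≥0∞} {C c : ℝ} (hC : 0 < C)
    (h : ∀ᶠ n : ℕ in atTop, ENNReal.ofReal (C * Real.exp (-(n * c))) ≤ u n) :
    ((-c : ℝ) : EReal) ≤ liminf (fun n : ℕ => ENNReal.log (u n) / (n : EReal)) atTop := by
  rw [← (tendsto_sub_mul_div_atTop (Real.log C) c).liminf_eq]
  refine liminf_le_liminf ?_
  filter_upwards [h] with n hn
  rw [← log_ofReal_mul_exp_div hC]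
  exact EReal.div_le_div_right_of_nonneg (by positivity) (ENNReal.log_monotone hn)

theorem limsup_log_div_le_neg {u : ℕ → ℝ≥0∞} {r : ℝ≥0∞} (hu : ∀ n, u n ≤ 1)
    (h : ∀ c : ℝ≥0, (c : ℝ≥0∞) < r →
      ∃ C : ℝ, 0 < C ∧ ∀ᶠ n : ℕ in atTop, u n ≤ ENNReal.ofReal (C * Real.exp (-(n * c)))) :
    limsup (fun n : ℕ => ENNReal.log (u n) / (n : EReal)) atTop ≤ -(r : EReal) := by
  set L := limsup (fun n : ℕ => ENNReal.log (u n) / (n : EReal)) atTop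
  have hL0 : 0 ≤ -L := by
    rw [EReal.le_neg]
    simpa using limsup_log_div_le (C := 1) (c := 0) one_pos (.of_forall fun n => by
      simpa using hu n)
  rw [EReal.le_neg, ← EReal.coe_toENNReal hL0, EReal.coe_ennreal_le_coe_ennreal_iff]
  refine ENNReal.le_of_forall_nnreal_lt fun c hc => ?_
  obtain ⟨C, hC, hCu⟩ := h c hc
  rw [← EReal.coe_ennreal_le_coe_ennreal_iff, EReal.coe_toENNReal hL0, EReal.le_neg]
  exact limsup_log_div_le hC hCu

theorem neg_le_liminf_log_div {u : ℕ → ℝ≥0∞} {r : ℝ≥0∞} (hr : r ≠ ⊤)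
    (h : ∀ ε : ℝ, 0 < ε → ∃ C : ℝ, 0 < C ∧
      ∀ᶠ n : ℕ in atTop, ENNReal.ofReal (C * Real.exp (-(n * (r.toReal + ε)))) ≤ u n) :
    -(r : EReal) ≤ liminf (fun n : ℕ => ENNReal.log (u n) / (n : EReal)) atTop := by
  lift r to ℝ≥0 using hr
  refine EReal.ge_of_forall_gt_iff_ge.1 fun x hx => ?_
  have hxr : x < -(r : ℝ) := EReal.coe_lt_coe_iff.1 hx
  obtain ⟨C, hC, hCu⟩ := h (-r - x) (by linarith)
  simpa using le_liminf_log_div hC hCu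

theorem SatisfiesLDP.of_exp_bounds {X : Type*} [TopologicalSpace X] [MeasurableSpace X]
    {τ : ℕ → Measure X} {ρ : X → ℝ≥0∞} (hτ : ∀ n s, τ n s ≤ 1) (hρ : LowerSemicontinuous ρ)
    (upper : ∀ F : Set X, IsClosed F → ∀ c : ℝ≥0, (∀ a ∈ F, (c : ℝ≥0∞) < ρ a) →
      ∃ C : ℝ, 0 < C ∧ ∀ᶠ n : ℕ in atTop, τ n F ≤ ENNReal.ofReal (C * Real.exp (-(n * c))))
    (lower : ∀ G : Set X, IsOpen G → ∀ a ∈ G, ρ a ≠ ⊤ → ∀ ε : ℝ, 0 < ε →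
      ∃ C : ℝ, 0 < C ∧ ∀ᶠ n : ℕ in atTop,
        ENNReal.ofReal (C * Real.exp (-(n * ((ρ a).toReal + ε)))) ≤ τ n G) :
    SatisfiesLDP τ ρ where
  lowerSemicontinuous := hρ
  upper_bound F hF := limsup_log_div_le_neg (fun n => hτ n F) fun c hc =>
    upper F hF c fun a ha => hc.trans_le (iInf₂_le a ha)
  lower_bound G hG := by
    set L := liminf (fun n : ℕ => ENNReal.log (τ n G) / (n : EReal)) atTop
    rw [EReal.neg_le]
    have hL : (-L).toENNReal ≤ ⨅ a ∈ G, ρ a := le_iInf₂ fun a ha => by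
      rcases eq_or_ne (ρ a) ⊤ with htop | hfin
      · simp [htop]
      · have h := EReal.neg_le.1 (neg_le_liminf_log_div hfin (lower G hG a ha hfin))
        simpa using EReal.toENNReal_le_toENNReal h
    calc -L ≤ ((-L).toENNReal : EReal) := by
          rw [EReal.coe_toENNReal_eq_max]
          exact le_max_right _ _
      _ ≤ _ := EReal.coe_ennreal_le_coe_ennreal_iff.2 hL

theorem lowerSemicontinuous_of_coe_ereal {X : Type*} [TopologicalSpace X] {f : X → ℝ≥0∞}
    (hf : LowerSemicontinuous fun x => (f x : EReal)) : LowerSemicontinuous f := by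
  intro x b hb
  filter_upwards [hf x b (EReal.coe_ennreal_lt_coe_ennreal_iff.2 hb)] with y hy
  exact EReal.coe_ennreal_lt_coe_ennreal_iff.1 hy

/-- The rate function of a constant sequence of measures with support `K`: `0` on `K` and `∞` off
`K`. -/
noncomputable def supportRate {X : Type*} (K : Set X) : X → ℝ≥0∞ :=
  Kᶜ.indicator fun _ => ⊤

theorem satisfiesLDP_const {X : Type*} [TopologicalSpace X] [HereditarilyLindelofSpace X]
    [MeasurableSpace X] (ν : Measure X) [IsProbabilityMeasure ν] :
    SatisfiesLDP (fun _ => ν) (supportRate ν.support) := by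
  refine SatisfiesLDP.of_exp_bounds (fun _ _ => prob_le_one)
    (Measure.isClosed_support.isOpen_compl.lowerSemicontinuous_indicator zero_le)
    (fun F _ c h => ⟨1, one_pos, .of_forall fun n => ?_⟩) (fun G hG a ha hfin ε hε => ?_)
  · have hF : F ⊆ ν.supportᶜ := fun a ha haK => by simpa [supportRate, haK] using h a ha
    simp [measure_mono_null hF Measure.measure_compl_support]
  · have haK : a ∈ ν.support := by
      by_contra hne
      simp [supportRate, hne] at hfin
    have hνG : 0 < ν G := (Measure.mem_support_iff_forall a).1 haK G (hG.mem_nhds ha)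
    refine ⟨(ν G).toReal, ENNReal.toReal_pos hνG.ne' (measure_ne_top _ _), .of_forall fun n => ?_⟩
    refine ENNReal.ofReal_le_of_le_toReal
      (mul_le_of_le_one_right ENNReal.toReal_nonneg (Real.exp_le_one_iff.2 ?_))
    exact neg_nonpos.2 (by positivity)

/-! ### The Poisson rate function -/

theorem poissonRate_of_neg {γ a : ℝ} (ha : a < 0) : poissonRate γ a = ⊤ := if_pos ha

theorem poissonRate_of_nonneg {γ a : ℝ} (ha : 0 ≤ a) (hγ : 0 < γ) :
    poissonRate γ a = ENNReal.ofReal (γ - a + a * Real.log (a / γ)) := by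
  rcases ha.eq_or_lt with rfl | ha
  · simp [poissonRate]
  · simp [poissonRate, ha.not_gt, ha.ne', hγ.ne']

theorem poissonRate_self {a : ℝ} (ha : 0 ≤ a) : poissonRate a a = 0 := by
  rcases ha.eq_or_lt with rfl | h
  · simp [poissonRate]
  · simp [poissonRate_of_nonneg ha h, div_self h.ne']

theorem coe_lt_poissonRate_iff {γ a : ℝ} {c : ℝ≥0} (hγ : 0 ≤ γ) :
    (c : ℝ≥0∞) < poissonRate γ a ↔ ∃ θ : ℝ, (c : ℝ) < θ * a - γ * (Real.exp θ - 1) := by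
  rw [← EReal.coe_ennreal_lt_coe_ennreal_iff, poissonRate_eq_legendre hγ, lt_iSup_iff]
  exact exists_congr fun θ => EReal.coe_lt_coe_iff

theorem exists_nonpos_coe_lt_tilt {γ a : ℝ} {c : ℝ≥0} (hγ : 0 ≤ γ) (ha : a ≤ γ)
    (h : (c : ℝ≥0∞) < poissonRate γ a) :
    ∃ θ ≤ 0, (c : ℝ) < θ * a - γ * (Real.exp θ - 1) := by
  obtain ⟨θ, hθ⟩ := (coe_lt_poissonRate_iff hγ).1 h
  refine ⟨θ, ?_, hθ⟩
  by_contra! hpos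
  nlinarith [c.coe_nonneg, Real.add_one_le_exp θ]

theorem exists_nonneg_coe_lt_tilt {γ a : ℝ} {c : ℝ≥0} (hγ : 0 ≤ γ) (ha : γ ≤ a)
    (h : (c : ℝ≥0∞) < poissonRate γ a) :
    ∃ θ ≥ 0, (c : ℝ) < θ * a - γ * (Real.exp θ - 1) := by
  obtain ⟨θ, hθ⟩ := (coe_lt_poissonRate_iff hγ).1 h
  refine ⟨θ, ?_, hθ⟩
  by_contra! hneg
  nlinarith [c.coe_nonneg, Real.add_one_le_exp θ]

theorem monotoneOn_poissonRate {a : ℝ} (ha : 0 ≤ a) :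
    MonotoneOn (fun γ => poissonRate γ a) (Set.Ici a) := by
  refine fun γ (hγ : a ≤ γ) γ' (hγ' : a ≤ γ') hle => ENNReal.le_of_forall_nnreal_lt fun c hc => ?_
  obtain ⟨θ, hθ, hcθ⟩ := exists_nonpos_coe_lt_tilt (ha.trans hγ) hγ hc
  refine ((coe_lt_poissonRate_iff (ha.trans hγ')).2 ⟨θ, ?_⟩).le
  nlinarith [Real.exp_le_one_iff.2 hθ]

theorem antitoneOn_poissonRate (a : ℝ) :
    AntitoneOn (fun γ => poissonRate γ a) (Set.Icc 0 a) := by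
  refine fun γ hγ γ' hγ' hle => ENNReal.le_of_forall_nnreal_lt fun c hc => ?_
  obtain ⟨θ, hθ, hcθ⟩ := exists_nonneg_coe_lt_tilt hγ'.1 hγ'.2 hc
  refine ((coe_lt_poissonRate_iff hγ.1).2 ⟨θ, ?_⟩).le
  nlinarith [Real.one_le_exp hθ]

theorem lowerSemicontinuous_poissonRate_comp {g : ℝ → ℝ} (hg : Continuous g) (hg0 : ∀ a, 0 ≤ g a) :
    LowerSemicontinuous fun a => poissonRate (g a) a := by
  refine lowerSemicontinuous_of_coe_ereal ?_
  simp_rw [poissonRate_eq_legendre (hg0 _)]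
  refine lowerSemicontinuous_iSup fun θ => Continuous.lowerSemicontinuous ?_
  exact continuous_coe_real_ereal.comp (by fun_prop)

theorem mixedPoissonRate_supportRate (K : Set ℝ) (a : ℝ) :
    mixedPoissonRate K (supportRate K) a = ⨅ γ ∈ K, poissonRate γ a :=
  iInf_congr fun γ => iInf_congr fun hγ => by simp [supportRate, hγ]

/-- The infimum over the support `[p, q]` is attained at the projection of `a` onto it. -/
theorem mixedPoissonRate_supportRate_Icc {p q : ℝ} (hp : 0 ≤ p) (hpq : p ≤ q) (a : ℝ) :
    mixedPoissonRate (Set.Icc p q) (supportRate (Set.Icc p q)) a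
      = poissonRate (max p (min q a)) a := by
  rw [mixedPoissonRate_supportRate]
  refine le_antisymm (iInf₂_le (max p (min q a)) (by simp [hpq])) (le_iInf₂ fun γ hγ => ?_)
  rcases lt_or_ge a 0 with ha | ha
  · simp [poissonRate_of_neg ha]
  rcases le_total a γ with haγ | haγ
  · exact monotoneOn_poissonRate ha (by simp [haγ.trans hγ.2]) haγ
      (max_le hγ.1 ((min_le_right q a).trans haγ))
  · exact antitoneOn_poissonRate a ⟨hp.trans hγ.1, haγ⟩
      ⟨hp.trans (le_max_left p _), max_le (hγ.1.trans haγ) (min_le_right q a)⟩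
      ((le_min hγ.2 haγ).trans (le_max_right p _))

section Mixture

variable {p q : ℝ}

theorem mixedPoissonRate_Icc_of_neg {a : ℝ} (ha : a < 0) :
    mixedPoissonRate (Set.Icc p q) (supportRate (Set.Icc p q)) a = ⊤ := by
  simp [mixedPoissonRate_supportRate, poissonRate_of_neg ha]

theorem mixedPoissonRate_Icc_of_le (hpq : p ≤ q) {a : ℝ} (ha : a ∈ Set.Icc 0 p) :
    mixedPoissonRate (Set.Icc p q) (supportRate (Set.Icc p q)) a = poissonRate p a := by
  rw [mixedPoissonRate_supportRate_Icc (ha.1.trans ha.2) hpq, min_eq_right (ha.2.trans hpq),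
    max_eq_left ha.2]

theorem mixedPoissonRate_Icc_of_mem (hp : 0 ≤ p) {a : ℝ} (ha : a ∈ Set.Icc p q) :
    mixedPoissonRate (Set.Icc p q) (supportRate (Set.Icc p q)) a = 0 := by
  rw [mixedPoissonRate_supportRate_Icc hp (ha.1.trans ha.2), min_eq_right ha.2, max_eq_right ha.1,
    poissonRate_self (hp.trans ha.1)]

theorem mixedPoissonRate_Icc_of_ge (hp : 0 ≤ p) (hpq : p ≤ q) {a : ℝ} (ha : q ≤ a) :
    mixedPoissonRate (Set.Icc p q) (supportRate (Set.Icc p q)) a = poissonRate q a := by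
  rw [mixedPoissonRate_supportRate_Icc hp hpq, min_eq_left ha, max_eq_right hpq]

theorem lowerSemicontinuous_mixedPoissonRate_Icc (hp : 0 ≤ p) (hpq : p ≤ q) :
    LowerSemicontinuous (mixedPoissonRate (Set.Icc p q) (supportRate (Set.Icc p q))) := by
  simp_rw [funext (mixedPoissonRate_supportRate_Icc hp hpq)]
  exact lowerSemicontinuous_poissonRate_comp (by fun_prop) fun a => hp.trans (le_max_left _ _)

end Mixture

/-! ### Positivity of transition probabilities -/

theorem exists_add_smul_one_apply_nonneg {E : Type*} [Finite E] [DecidableEq E]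
    {Q : Matrix E E ℝ} (hQ : ∀ i j, i ≠ j → 0 ≤ Q i j) :
    ∃ c : ℝ, ∀ i j, 0 ≤ (Q + c • (1 : Matrix E E ℝ)) i j := by
  cases nonempty_fintype E
  refine ⟨∑ i, |Q i i|, fun i j => ?_⟩
  rcases eq_or_ne i j with rfl | hij
  · have h : |Q i i| ≤ ∑ i, |Q i i| :=
      Finset.single_le_sum (fun i _ => abs_nonneg (Q i i)) (Finset.mem_univ i)
    simpa using by linarith [neg_abs_le (Q i i)]
  · simpa [hij] using hQ i j hij

section MatrixExp

variable {E : Type*} [Fintype E] [DecidableEq E]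

theorem hasSum_matrix_exp_apply (A : Matrix E E ℝ) (i j : E) :
    HasSum (fun k : ℕ => ((k.factorial : ℝ)⁻¹) * (A ^ k) i j) (NormedSpace.exp A i j) := by
  let : NormedRing (Matrix E E ℝ) := Matrix.linftyOpNormedRing
  let : NormedAlgebra ℝ (Matrix E E ℝ) := Matrix.linftyOpNormedAlgebra
  have h : HasSum (fun k : ℕ => ((k.factorial : ℝ)⁻¹) • A ^ k) (NormedSpace.exp A) :=
    NormedSpace.exp_series_hasSum_exp' A
  exact Pi.hasSum.1 (Pi.hasSum.1 h i) j

theorem inv_factorial_mul_pow_apply_le_matrix_exp_apply {A : Matrix E E ℝ}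
    (hA : ∀ i j, 0 ≤ A i j) (k : ℕ) (i j : E) :
    ((k.factorial : ℝ)⁻¹) * (A ^ k) i j ≤ NormedSpace.exp A i j :=
  le_hasSum (hasSum_matrix_exp_apply A i j) k fun l _ =>
    mul_nonneg (by positivity) (Matrix.pow_apply_nonneg hA l i j)

theorem exists_matrix_pow_apply_pos {A : Matrix E E ℝ} (hA : ∀ i j, 0 ≤ A i j) {i j : E}
    (h : Relation.ReflTransGen (fun x y => 0 < A x y) i j) : ∃ k, 0 < (A ^ k) i j := by
  induction h with
  | refl => exact ⟨0, by simp⟩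
  | @tail b c _ hbc ih =>
    obtain ⟨k, hk⟩ := ih
    refine ⟨k + 1, ?_⟩
    rw [pow_succ, Matrix.mul_apply]
    exact Finset.sum_pos' (fun l _ => mul_nonneg (Matrix.pow_apply_nonneg hA k i l) (hA l c))
      ⟨b, Finset.mem_univ _, mul_pos hk hbc⟩

theorem matrix_exp_smul_one (c : ℝ) :
    NormedSpace.exp (c • (1 : Matrix E E ℝ)) = Real.exp c • (1 : Matrix E E ℝ) := by
  rw [Matrix.smul_one_eq_diagonal, Matrix.exp_diagonal, Matrix.smul_one_eq_diagonal]
  congr 1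
  ext i
  rw [Pi.coe_exp, ← Real.exp_eq_exp_ℝ]

theorem matrix_exp_smul_eq_exp_neg_smul (Q : Matrix E E ℝ) (c h : ℝ) :
    NormedSpace.exp (h • Q)
      = Real.exp (-(c * h)) • NormedSpace.exp (h • (Q + c • (1 : Matrix E E ℝ))) := by
  have hQ : h • Q = (-(c * h)) • (1 : Matrix E E ℝ) + h • (Q + c • (1 : Matrix E E ℝ)) := by
    module
  rw [hQ, Matrix.exp_add_of_commute _ _ ((Commute.one_left _).smul_left _), matrix_exp_smul_one,
    smul_mul_assoc, one_mul]

variable {Q : Matrix E E ℝ}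

theorem exists_exp_neg_mul_le_matrix_exp_smul_apply (hQ : ∀ i j, i ≠ j → 0 ≤ Q i j) :
    ∃ c : ℝ, ∀ h, 0 ≤ h → ∀ i, Real.exp (-(c * h)) ≤ NormedSpace.exp (h • Q) i i := by
  obtain ⟨c, hc⟩ := exists_add_smul_one_apply_nonneg hQ
  refine ⟨c, fun h hh i => ?_⟩
  rw [matrix_exp_smul_eq_exp_neg_smul Q c h, Matrix.smul_apply, smul_eq_mul]
  refine le_mul_of_one_le_right (Real.exp_pos _).le ?_
  simpa using inv_factorial_mul_pow_apply_le_matrix_exp_apply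
    (A := h • (Q + c • (1 : Matrix E E ℝ))) (fun i j => mul_nonneg hh (hc i j)) 0 i i

theorem matrix_exp_smul_apply_pos (hQ : ∀ i j, i ≠ j → 0 ≤ Q i j)
    (hirr : IsIrreducibleGenerator Q) {h : ℝ} (hh : 0 < h) (i j : E) :
    0 < NormedSpace.exp (h • Q) i j := by
  obtain ⟨c, hc⟩ := exists_add_smul_one_apply_nonneg hQ
  have hA : ∀ i j, 0 ≤ (h • (Q + c • (1 : Matrix E E ℝ))) i j :=
    fun i j => mul_nonneg hh.le (hc i j)
  have hpos : ∀ x y, x ≠ y ∧ 0 < Q x y → 0 < (h • (Q + c • (1 : Matrix E E ℝ))) x y :=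
    fun x y hxy => by simpa [Matrix.one_apply_ne hxy.1] using mul_pos hh hxy.2
  obtain ⟨k, hk⟩ := exists_matrix_pow_apply_pos hA (Relation.ReflTransGen.mono hpos _ _ (hirr i j))
  rw [matrix_exp_smul_eq_exp_neg_smul Q c h, Matrix.smul_apply, smul_eq_mul]
  exact mul_pos (Real.exp_pos _) ((mul_pos (by positivity) hk).trans_le
    (inv_factorial_mul_pow_apply_le_matrix_exp_apply hA k i j))

end MatrixExp

/-! ### Càdlàg paths in a discrete space -/

section Cadlag

variable {E : Type*} [TopologicalSpace E] [DiscreteTopology E] {f : ℝ≥0 → E}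

theorem IsCadlagPath.eventually_eventually_eq (hf : IsCadlagPath f) (s : ℝ≥0) :
    ∀ᶠ u in 𝓝[≠] s, ∀ᶠ r in 𝓝 u, f r = f u := by
  have locally_eq : ∀ {U : Set ℝ≥0}, IsOpen U → ∀ l : E, (∀ᶠ u in 𝓝[U] s, f u = l) →
      ∀ᶠ u in 𝓝[U] s, ∀ᶠ r in 𝓝 u, f r = f u := by
    intro U hU l hl
    filter_upwards [eventually_eventually_nhdsWithin.2 hl, hl, self_mem_nhdsWithin]
      with u hu hul huU
    rw [hU.nhdsWithin_eq huU] at hu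
    simpa only [hul] using hu
  rw [← Set.Iio_union_Ioi, nhdsWithin_union, eventually_sup]
  constructor
  · rcases eq_zero_or_pos s with rfl | hs
    · simp
    · obtain ⟨l, hl⟩ := hf.2 s hs
      exact locally_eq isOpen_Iio l (by simpa using hl)
  · have hright : Tendsto f (𝓝[>] s) (𝓝 (f s)) := (hf.1 s).mono Set.Ioi_subset_Ici_self
    exact locally_eq isOpen_Ioi (f s) (by simpa using hright)

theorem IsCadlagPath.ae_eventually_eq (hf : IsCadlagPath f) (t : ℝ) :
    ∀ᵐ s ∂volume.restrict (Set.Ioc 0 t), ∀ᶠ r in 𝓝 s.toNNReal, f r = f s.toNNReal := by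
  set D : Set ℝ≥0 := {s | ¬ ∀ᶠ r in 𝓝 s, f r = f s} with hD
  have : DiscreteTopology D := discreteTopology_subtype_iff.2 fun s _ =>
    disjoint_iff.1 (disjoint_principal_right.2 (by
      filter_upwards [hf.eventually_eventually_eq s] with u hu
      simpa [hD] using hu))
  have hDc : D.Countable := countable_of_Lindelof_of_discrete
  filter_upwards [ae_restrict_mem measurableSet_Ioc,
    ae_restrict_of_ae ((hDc.image ((↑) : ℝ≥0 → ℝ)).ae_notMem volume)] with s hs hsD
  by_contra hne
  exact hsD ⟨s.toNNReal, hne, Real.coe_toNNReal _ hs.1.le⟩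

theorem tendsto_floor_add_one_div (s : ℝ≥0) :
    Tendsto (fun n : ℕ => ((⌊s * (n + 1)⌋₊ : ℝ≥0) + 1) / (n + 1)) atTop (𝓝[≥] s) := by
  have lower : ∀ n : ℕ, s ≤ ((⌊s * (n + 1)⌋₊ : ℝ≥0) + 1) / (n + 1) := fun n => by
    rw [le_div_iff₀ (by positivity)]
    exact (Nat.lt_floor_add_one _).le
  have upper : ∀ n : ℕ, ((⌊s * (n + 1)⌋₊ : ℝ≥0) + 1) / (n + 1) ≤ s + 1 / ((n : ℝ≥0) + 1) :=
    fun n => by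
      rw [add_div]
      gcongr
      exact div_le_of_le_mul₀ zero_le zero_le (Nat.floor_le zero_le)
  have hub : Tendsto (fun n : ℕ => s + 1 / ((n : ℝ≥0) + 1)) atTop (𝓝 s) := by
    simpa using (tendsto_const_nhds (x := s)).add tendsto_one_div_add_atTop_nhds_zero_nat
  exact tendsto_nhdsWithin_iff.2
    ⟨tendsto_of_tendsto_of_tendsto_of_le_of_le tendsto_const_nhds hub lower upper, .of_forall lower⟩

variable [MeasurableSpace E] [DiscreteMeasurableSpace E]

/-- Right continuity exhibits the process as a limit of processes that are constant between
the points of a grid. -/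
theorem measurable_uncurry_of_isCadlagPath {S : Type*} [MeasurableSpace S] {J : ℝ≥0 → S → E}
    (hm : ∀ s, Measurable (J s)) (hc : ∀ ω, IsCadlagPath fun s => J s ω) :
    Measurable fun p : S × ℝ≥0 => J p.2 p.1 := by
  refine measurable_of_tendsto_metrizable
    (f := fun (n : ℕ) (p : S × ℝ≥0) => J (((⌊p.2 * (n + 1)⌋₊ : ℝ≥0) + 1) / (n + 1)) p.1)
    (fun n => ?_) (tendsto_pi_nhds.2 fun p =>
      ((hc p.1).1 p.2).tendsto.comp (tendsto_floor_add_one_div p.2))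
  have hgrid : ∀ a : ℕ → ℝ≥0, Measurable fun p : S × ℝ≥0 => J (a ⌊p.2 * (n + 1)⌋₊) p.1 :=
    fun a => (measurable_from_prod_countable_left fun k => hm (a k) :
        Measurable fun q : S × ℕ => J (a q.2) q.1).comp
      (measurable_fst.prodMk (Nat.measurable_floor.comp (measurable_snd.mul_const _)))
  exact hgrid fun k => ((k : ℝ≥0) + 1) / (n + 1)

theorem IsCadlagPath.measurable (hf : IsCadlagPath f) : Measurable f :=
  (measurable_uncurry_of_isCadlagPath (S := Unit) (J := fun s _ => f s) (fun _ => measurable_const)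
    fun _ => hf).comp (measurable_const.prodMk measurable_id : Measurable fun s : ℝ≥0 => ((), s))

end Cadlag

section Splice

variable {E : Type*}

/-- The path that follows `g` before time `θ` and `h` from then on. It interpolates between `h`
(at `θ = 0`) and `g`. -/
noncomputable def splice (g h : ℝ≥0 → E) (θ s : ℝ≥0) : E := if s < θ then g s else h s

theorem splice_of_lt {g h : ℝ≥0 → E} {θ s : ℝ≥0} (hs : s < θ) : splice g h θ s = g s := if_pos hs

theorem splice_of_le {g h : ℝ≥0 → E} {θ s : ℝ≥0} (hs : θ ≤ s) : splice g h θ s = h s :=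
  if_neg hs.not_gt

theorem eventually_splice_eq {g h : ℝ≥0 → E} {θ s : ℝ≥0} (hs : s ≠ θ) :
    ∀ᶠ θ' in 𝓝 θ, splice g h θ' s = splice g h θ s := by
  rcases lt_or_gt_of_ne hs with hs | hs
  · filter_upwards [Ioi_mem_nhds hs] with θ' hθ'
    rw [splice_of_lt hθ', splice_of_lt hs]
  · filter_upwards [Iio_mem_nhds hs] with θ' hθ'
    rw [splice_of_le (le_of_lt hθ'), splice_of_le hs.le]

theorem IsCadlagPath.splice [TopologicalSpace E] {g h : ℝ≥0 → E} (hg : IsCadlagPath g)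
    (hh : IsCadlagPath h) (θ : ℝ≥0) : IsCadlagPath (splice g h θ) := by
  refine ⟨fun s => ?_, fun s hs0 => ?_⟩
  · rcases lt_or_ge s θ with hs | hs
    · refine (hg.1 s).congr_of_eventuallyEq ?_ (splice_of_lt hs)
      filter_upwards [mem_nhdsWithin_of_mem_nhds (Iio_mem_nhds hs)] with r hr using splice_of_lt hr
    · exact (hh.1 s).congr (fun r hr => splice_of_le (hs.trans hr)) (splice_of_le hs)
  · rcases le_or_gt s θ with hs | hs
    · obtain ⟨l, hl⟩ := hg.2 s hs0
      refine ⟨l, hl.congr' ?_⟩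
      filter_upwards [self_mem_nhdsWithin] with r hr
        using (splice_of_lt (lt_of_lt_of_le hr hs)).symm
    · obtain ⟨l, hl⟩ := hh.2 s hs0
      refine ⟨l, hl.congr' ?_⟩
      filter_upwards [mem_nhdsWithin_of_mem_nhds (Ioi_mem_nhds hs)] with r hr
        using (splice_of_le (le_of_lt hr)).symm

end Splice

/-! ### The random Poisson parameter as a functional of the path -/

section Phi

variable {E : Type*}

theorem pathIntegral_nonneg (g : E → ℝ≥0) (f : ℝ≥0 → E) {u v : ℝ≥0} (h : u ≤ v) :
    0 ≤ pathIntegral g f u v :=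
  intervalIntegral.integral_nonneg (by exact_mod_cast h) fun _ _ => NNReal.coe_nonneg _

/-- The integrand of `phi`: the rate at which jobs arrive at time `s` that are still present at
time `t`. -/
noncomputable def phiIntegrand (lam kap mu : E → ℝ≥0) (t : ℝ≥0) (f : ℝ≥0 → E) (s : ℝ) : ℝ :=
  (lam (f s.toNNReal) : ℝ) * Real.exp (-(kap (f s.toNNReal) : ℝ) * pathIntegral mu f s.toNNReal t)

theorem phiIntegrand_nonneg (lam kap mu : E → ℝ≥0) (t : ℝ≥0) (f : ℝ≥0 → E) (s : ℝ) :
    0 ≤ phiIntegrand lam kap mu t f s :=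
  mul_nonneg (NNReal.coe_nonneg _) (Real.exp_pos _).le

theorem phiIntegrand_le (lam kap mu : E → ℝ≥0) {t : ℝ≥0} (f : ℝ≥0 → E) {s : ℝ} (hs : s ≤ t) :
    phiIntegrand lam kap mu t f s ≤ lam (f s.toNNReal) := by
  refine mul_le_of_le_one_right (NNReal.coe_nonneg _) (Real.exp_le_one_iff.2 ?_)
  have := pathIntegral_nonneg mu f (Real.toNNReal_le_iff_le_coe.2 hs)
  rw [neg_mul, neg_nonpos]
  positivity

theorem phi_nonneg (lam kap mu : E → ℝ≥0) (t : ℝ≥0) (f : ℝ≥0 → E) : 0 ≤ phi lam kap mu t f :=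
  intervalIntegral.integral_nonneg t.coe_nonneg fun s _ => phiIntegrand_nonneg lam kap mu t f s

theorem phi_const_mul (c : ℝ≥0) (lam kap mu : E → ℝ≥0) (t : ℝ≥0) (f : ℝ≥0 → E) :
    phi (fun x => c * lam x) kap mu t f = c * phi lam kap mu t f := by
  simp only [phi, NNReal.coe_mul, mul_assoc, intervalIntegral.integral_const_mul]

theorem phi_congr (lam kap mu : E → ℝ≥0) {t : ℝ≥0} {f g : ℝ≥0 → E} (h : ∀ s < t, f s = g s) :
    phi lam kap mu t f = phi lam kap mu t g := by
  have toNNReal_lt : ∀ {r : ℝ}, 0 ≤ r → r < t → r.toNNReal < t := fun hr hrt =>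
    (Real.toNNReal_lt_iff_lt_coe hr).2 hrt
  have integral_congr : ∀ {F G : ℝ → ℝ} {s : ℝ≥0}, s ≤ t →
      (∀ r ∈ Set.Ioo (s : ℝ) t, F r = G r) → ∫ r in (s : ℝ)..t, F r = ∫ r in (s : ℝ)..t, G r := by
    intro F G s hs hFG
    simp only [intervalIntegral.integral_of_le (NNReal.coe_le_coe.2 hs),
      integral_Ioc_eq_integral_Ioo]
    exact setIntegral_congr_fun measurableSet_Ioo hFG
  refine integral_congr zero_le fun s hs => ?_
  have hst := toNNReal_lt hs.1.le hs.2
  rw [h _ hst, pathIntegral, pathIntegral, integral_congr hst.le fun r hr => ?_]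
  rw [h _ (toNNReal_lt (NNReal.coe_nonneg _ |>.trans hr.1.le) hr.2)]

variable [Finite E]

theorem exists_forall_coe_le (g : E → ℝ≥0) : ∃ C : ℝ, ∀ x, (g x : ℝ) ≤ C := by
  obtain ⟨C, hC⟩ := (Set.finite_range g).bddAbove
  exact ⟨C, fun x => NNReal.coe_le_coe.2 (hC ⟨x, rfl⟩)⟩

theorem exists_phi_le (lam kap mu : E → ℝ≥0) (t : ℝ≥0) : ∃ C, ∀ f, phi lam kap mu t f ≤ C := by
  obtain ⟨C, hC⟩ := exists_forall_coe_le lam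
  refine ⟨C * |(t : ℝ) - 0|, fun f => (Real.le_norm_self _).trans
    (intervalIntegral.norm_integral_le_of_norm_le_const fun s hs => ?_)⟩
  rw [Set.uIoc_of_le t.coe_nonneg] at hs
  exact (Real.norm_of_nonneg (phiIntegrand_nonneg lam kap mu t f s)).trans_le
    ((phiIntegrand_le lam kap mu f hs.2).trans (hC _))

variable [MeasurableSpace E] [DiscreteMeasurableSpace E]

theorem intervalIntegrable_rate_comp (g : E → ℝ≥0) {f : ℝ≥0 → E} (hf : Measurable f) (a b : ℝ) :
    IntervalIntegrable (fun r : ℝ => (g (f r.toNNReal) : ℝ)) volume a b := by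
  obtain ⟨C, hC⟩ := exists_forall_coe_le g
  rw [intervalIntegrable_iff]
  exact Measure.integrableOn_of_bounded measure_Ioc_lt_top.ne
    (Measurable.of_discrete.comp
      (hf.comp measurable_real_toNNReal)).coe_nnreal_real.aestronglyMeasurable
    (.of_forall fun r => (Real.norm_of_nonneg (NNReal.coe_nonneg _)).trans_le (hC _))

theorem pathIntegral_eq_sub (g : E → ℝ≥0) {f : ℝ≥0 → E} (hf : Measurable f) (u v : ℝ≥0) :
    pathIntegral g f u v = pathIntegral g f 0 v - pathIntegral g f 0 u :=
  (intervalIntegral.integral_interval_sub_left (intervalIntegrable_rate_comp g hf _ _)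
    (intervalIntegrable_rate_comp g hf _ _)).symm

theorem continuous_pathIntegral (g : E → ℝ≥0) {f : ℝ≥0 → E} (hf : Measurable f) :
    Continuous fun u : ℝ≥0 => pathIntegral g f 0 u :=
  (intervalIntegral.continuous_primitive (intervalIntegrable_rate_comp g hf) _).comp
    NNReal.continuous_coe

theorem monotone_pathIntegral (g : E → ℝ≥0) {f : ℝ≥0 → E} (hf : Measurable f) :
    Monotone fun u : ℝ≥0 => pathIntegral g f 0 u := fun u v h =>
  sub_nonneg.1 ((pathIntegral_nonneg g f h).trans_eq (pathIntegral_eq_sub g hf u v))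

end Phi

section RandomPath

variable {S E : Type*} [MeasurableSpace S]

theorem measurable_intervalIntegral_param {F : S → ℝ → ℝ} (hF : Measurable (Function.uncurry F)) :
    Measurable fun p : S × ℝ≥0 => ∫ r in (0 : ℝ)..p.2, F p.1 r := by
  have as_indicator : ∀ p : S × ℝ≥0, ∫ r in (0 : ℝ)..p.2, F p.1 r =
      ∫ r, (Set.Ioc (0 : ℝ) p.2).indicator (F p.1) r := fun p => by
    rw [intervalIntegral.integral_of_le p.2.coe_nonneg, integral_indicator measurableSet_Ioc]
  simp only [as_indicator]
  refine (StronglyMeasurable.integral_prod_right (ν := (volume : Measure ℝ))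
    (f := fun (p : S × ℝ≥0) (r : ℝ) => (Set.Ioc (0 : ℝ) p.2).indicator (F p.1) r)
    (Measurable.stronglyMeasurable ?_)).measurable
  exact Measurable.ite ((measurableSet_lt measurable_const measurable_snd).inter
      (measurableSet_le measurable_snd measurable_fst.snd.coe_nnreal_real))
    (hF.comp (measurable_fst.fst.prodMk measurable_snd)) measurable_const

variable [MeasurableSpace E] [DiscreteMeasurableSpace E] {J : ℝ≥0 → S → E}

theorem measurable_rate_uncurry (hJ : Measurable fun p : S × ℝ≥0 => J p.2 p.1) (g : E → ℝ≥0) :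
    Measurable fun p : S × ℝ => (g (J p.2.toNNReal p.1) : ℝ) :=
  (Measurable.of_discrete.comp
    (hJ.comp (measurable_fst.prodMk measurable_snd.real_toNNReal))).coe_nnreal_real

theorem measurable_pathIntegral_uncurry (hJ : Measurable fun p : S × ℝ≥0 => J p.2 p.1)
    (g : E → ℝ≥0) : Measurable fun p : S × ℝ≥0 => pathIntegral g (fun s => J s p.1) 0 p.2 :=
  measurable_intervalIntegral_param (F := fun ω r => (g (J r.toNNReal ω) : ℝ))
    (measurable_rate_uncurry hJ g)

variable [Finite E]

theorem measurable_pathIntegral_uncurry_left (hJ : Measurable fun p : S × ℝ≥0 => J p.2 p.1)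
    (g : E → ℝ≥0) (t : ℝ≥0) :
    Measurable fun p : S × ℝ≥0 => pathIntegral g (fun s => J s p.1) p.2 t := by
  have h := measurable_pathIntegral_uncurry hJ g
  have path_measurable : ∀ ω, Measurable fun s => J s ω := fun ω =>
    hJ.comp (measurable_const.prodMk measurable_id)
  simp only [fun p : S × ℝ≥0 => pathIntegral_eq_sub g (path_measurable p.1) p.2 t]
  exact (h.comp (measurable_fst.prodMk measurable_const)).sub h

theorem measurable_phiIntegrand_uncurry (hJ : Measurable fun p : S × ℝ≥0 => J p.2 p.1)
    (lam kap mu : E → ℝ≥0) (t : ℝ≥0) :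
    Measurable fun p : S × ℝ => phiIntegrand lam kap mu t (fun s => J s p.1) p.2 :=
  (measurable_rate_uncurry hJ lam).mul (((measurable_rate_uncurry hJ kap).neg.mul
    ((measurable_pathIntegral_uncurry_left hJ mu t).comp
      (measurable_fst.prodMk measurable_snd.real_toNNReal))).exp)

theorem measurable_phiIntegrand (lam kap mu : E → ℝ≥0) (t : ℝ≥0) {f : ℝ≥0 → E}
    (hf : Measurable f) : Measurable (phiIntegrand lam kap mu t f) :=
  (measurable_phiIntegrand_uncurry (S := Unit) (J := fun s _ => f s) (hf.comp measurable_snd)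
    lam kap mu t).comp (measurable_const.prodMk measurable_id : Measurable fun s : ℝ => ((), s))

theorem measurable_phi (hJ : Measurable fun p : S × ℝ≥0 => J p.2 p.1) (lam kap mu : E → ℝ≥0)
    (t : ℝ≥0) : Measurable fun ω => phi lam kap mu t fun s => J s ω :=
  (measurable_intervalIntegral_param (F := fun ω => phiIntegrand lam kap mu t fun s => J s ω)
    (measurable_phiIntegrand_uncurry hJ lam kap mu t)).comp
    (measurable_id.prodMk (measurable_const (a := t)))

end RandomPath

section PhiContinuity

variable {E : Type*} [Finite E] [MeasurableSpace E] [DiscreteMeasurableSpace E]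
  {ι : Type*} {l : Filter ι} [l.IsCountablyGenerated] {f : ι → ℝ≥0 → E} {f₀ : ℝ≥0 → E} {t : ℝ≥0}

theorem tendsto_pathIntegral (g : E → ℝ≥0) (hf : ∀ i, Measurable (f i))
    (hlim : ∀ᵐ s ∂volume.restrict (Set.Ioc (0 : ℝ) t), ∀ᶠ i in l,
      f i s.toNNReal = f₀ s.toNNReal) {u : ℝ≥0} (hu : u ≤ t) :
    Tendsto (fun i => pathIntegral g (f i) u t) l (𝓝 (pathIntegral g f₀ u t)) := by
  obtain ⟨C, hC⟩ := exists_forall_coe_le g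
  refine intervalIntegral.tendsto_integral_filter_of_dominated_convergence (fun _ => C)
    (.of_forall fun i =>
      (intervalIntegrable_rate_comp g (hf i) u t).aestronglyMeasurable_restrict_uIoc)
    (.of_forall fun i => .of_forall fun s _ =>
      (Real.norm_of_nonneg (NNReal.coe_nonneg _)).trans_le (hC _))
    intervalIntegrable_const ?_
  filter_upwards [(ae_restrict_iff' measurableSet_Ioc).1 hlim] with s hs hsI
  rw [Set.uIoc_of_le (NNReal.coe_le_coe.2 hu)] at hsI
  exact tendsto_const_nhds.congr' ((hs ⟨u.coe_nonneg.trans_lt hsI.1, hsI.2⟩).mono fun i hi => by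
    simp only [hi])

theorem tendsto_phi (lam kap mu : E → ℝ≥0) (hf : ∀ i, Measurable (f i))
    (hlim : ∀ᵐ s ∂volume.restrict (Set.Ioc (0 : ℝ) t), ∀ᶠ i in l,
      f i s.toNNReal = f₀ s.toNNReal) :
    Tendsto (fun i => phi lam kap mu t (f i)) l (𝓝 (phi lam kap mu t f₀)) := by
  obtain ⟨C, hC⟩ := exists_forall_coe_le lam
  refine intervalIntegral.tendsto_integral_filter_of_dominated_convergence (fun _ => C)
    (.of_forall fun i => (measurable_phiIntegrand lam kap mu t (hf i)).aestronglyMeasurable)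
    (.of_forall fun i => .of_forall fun s hs => ?_) intervalIntegrable_const ?_
  · rw [Set.uIoc_of_le t.coe_nonneg] at hs
    exact (Real.norm_of_nonneg (phiIntegrand_nonneg lam kap mu t (f i) s)).trans_le
      ((phiIntegrand_le lam kap mu (f i) hs.2).trans (hC _))
  · filter_upwards [(ae_restrict_iff' measurableSet_Ioc).1 hlim] with s hs hsI
    rw [Set.uIoc_of_le t.coe_nonneg] at hsI
    have hmu := tendsto_pathIntegral mu hf hlim (Real.toNNReal_le_iff_le_coe.2 hsI.2)
    refine ((hmu.const_mul (-(kap (f₀ s.toNNReal) : ℝ))).rexp.const_mul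
      (lam (f₀ s.toNNReal) : ℝ)).congr' ((hs hsI).mono fun i hi => ?_)
    simp only [hi]

theorem ordConnected_phi_image [TopologicalSpace E] [DiscreteTopology E] (lam kap mu : E → ℝ≥0)
    (t : ℝ≥0) : (phi lam kap mu t '' {g | IsCadlagPath g}).OrdConnected := by
  refine Set.OrdConnected.mk ?_
  rintro _ ⟨h, hh, rfl⟩ _ ⟨g, hg, rfl⟩ b hb
  have hcont : Continuous fun θ => phi lam kap mu t (splice g h θ) := by
    refine continuous_iff_continuousAt.2 fun θ =>
      tendsto_phi lam kap mu (fun θ' => (hg.splice hh θ').measurable) ?_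
    filter_upwards [ae_restrict_mem measurableSet_Ioc,
      ae_restrict_of_ae (measure_eq_zero_iff_ae_notMem.1 (measure_singleton (θ : ℝ)))] with s hs hsθ
    refine eventually_splice_eq fun hst => hsθ ?_
    rw [Set.mem_singleton_iff, ← hst, Real.coe_toNNReal _ hs.1.le]
  have hstart : phi lam kap mu t (splice g h 0) = phi lam kap mu t h :=
    phi_congr lam kap mu fun s _ => splice_of_le zero_le
  have hend : phi lam kap mu t (splice g h t) = phi lam kap mu t g :=
    phi_congr lam kap mu fun s hs => splice_of_lt hs
  obtain ⟨θ, -, rfl⟩ := intermediate_value_Icc (zero_le (a := t)) hcont.continuousOn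
    (by rwa [hstart, hend])
  exact ⟨_, hg.splice hh θ, rfl⟩

end PhiContinuity

/-! ### The support of a Markov chain -/

section Markov

theorem tendsto_floor_div (s : ℝ≥0) :
    Tendsto (fun n : ℕ => (⌊s * (n + 1)⌋₊ : ℝ≥0) * (1 / (n + 1))) atTop (𝓝 s) := by
  have h := ((tendsto_floor_add_one_div s).mono_right nhdsWithin_le_nhds).sub
    (tendsto_one_div_add_atTop_nhds_zero_nat (𝕜 := ℝ≥0))
  rw [tsub_zero] at h
  refine h.congr fun n => ?_
  rw [add_div, add_tsub_cancel_right, mul_one_div]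

theorem eventually_grid_eq {E : Type*} {g : ℝ≥0 → E} {s : ℝ≥0} (hs : 0 < s)
    (hg : ∀ᶠ r in 𝓝 s, g r = g s) :
    ∀ᶠ m : ℕ in atTop, ⌊s * (m + 1)⌋₊ ≠ 0 ∧ g (⌊s * (m + 1)⌋₊ * (1 / (m + 1))) = g s ∧
      g ((⌊s * (m + 1)⌋₊ + 1 : ℕ) * (1 / (m + 1))) = g s := by
  have before := tendsto_floor_div s
  have after : Tendsto (fun m : ℕ => (⌊s * (m + 1)⌋₊ + 1 : ℕ) * (1 / ((m : ℝ≥0) + 1))) atTop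
      (𝓝 s) := by
    simpa only [Nat.cast_succ, mul_one_div] using
      (tendsto_floor_add_one_div s).mono_right nhdsWithin_le_nhds
  filter_upwards [before.eventually hg, after.eventually hg, before.eventually_ne hs.ne']
    with m hbefore hafter hpos
  exact ⟨fun h => hpos (by rw [h, Nat.cast_zero, zero_mul]), hbefore, hafter⟩

theorem exists_measure_preimage_singleton_pos {Ω E : Type*} [MeasurableSpace Ω] [Countable E]
    (P : Measure Ω) [NeZero P] (X : Ω → E) : ∃ x, 0 < P (X ⁻¹' {x}) := by
  by_contra! h
  refine NeZero.ne P (Measure.measure_univ_eq_zero.1 ?_)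
  rw [← Set.preimage_univ (f := X), ← Set.iUnion_of_singleton, Set.preimage_iUnion]
  exact measure_iUnion_null fun x => nonpos_iff_eq_zero.1 (h x)

/-- The history of a process up to time `s`. -/
abbrev processHistory {Ω E : Type*} [MeasurableSpace E] (J : ℝ≥0 → Ω → E) (s : ℝ≥0) :
    MeasurableSpace Ω :=
  ⨆ (r : ℝ≥0) (_ : r ≤ s), MeasurableSpace.comap (J r) inferInstance

theorem processHistory_mono {Ω E : Type*} [MeasurableSpace E] (J : ℝ≥0 → Ω → E) :
    Monotone (processHistory J) := fun _ u h =>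
  iSup₂_le fun r hr =>
    le_iSup₂ (f := fun r (_ : r ≤ u) => MeasurableSpace.comap (J r) inferInstance) r (hr.trans h)

theorem measurableSet_processHistory {Ω E : Type*} [MeasurableSpace E]
    [MeasurableSingletonClass E] (J : ℝ≥0 → Ω → E) {r s : ℝ≥0} (h : r ≤ s) (i : E) :
    MeasurableSet[processHistory J s] (J r ⁻¹' {i}) :=
  le_iSup₂ (f := fun r (_ : r ≤ s) => MeasurableSpace.comap (J r) inferInstance) r h _
    ⟨{i}, measurableSet_singleton i, rfl⟩

/-- The event that `J` visits the states `y 0, …, y n` at the times `0, δ, …, n δ`. -/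
def gridEvent {Ω E : Type*} (J : ℝ≥0 → Ω → E) (δ : ℝ≥0) (y : ℕ → E) (n : ℕ) : Set Ω :=
  {ω | ∀ k ≤ n, J (k * δ) ω = y k}

theorem gridEvent_succ {Ω E : Type*} (J : ℝ≥0 → Ω → E) (δ : ℝ≥0) (y : ℕ → E) (n : ℕ) :
    gridEvent J δ y (n + 1) = gridEvent J δ y n ∩ J ((n + 1 : ℕ) * δ) ⁻¹' {y (n + 1)} := by
  ext ω
  simp only [gridEvent, Set.mem_ofPred_eq, Nat.le_succ_iff_eq_or_le, forall_eq_or_imp,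
    Set.mem_inter_iff, Set.mem_preimage, Set.mem_singleton_iff, and_comm]

theorem gridEvent_inter_preimage {Ω E : Type*} (J : ℝ≥0 → Ω → E) (δ : ℝ≥0) (y : ℕ → E) (n : ℕ) :
    gridEvent J δ y n ∩ J (n * δ) ⁻¹' {y n} = gridEvent J δ y n :=
  Set.inter_eq_left.2 fun _ hω => hω n le_rfl

theorem measurableSet_processHistory_gridEvent {Ω E : Type*} [MeasurableSpace E]
    [MeasurableSingletonClass E] (J : ℝ≥0 → Ω → E) (δ : ℝ≥0) (y : ℕ → E) (n : ℕ) :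
    MeasurableSet[processHistory J (n * δ)] (gridEvent J δ y n) := by
  simp only [gridEvent, Set.ofPred_forall]
  exact MeasurableSet.iInter fun k => MeasurableSet.iInter fun hk =>
    measurableSet_processHistory J (by gcongr) (y k)

variable {Ω E : Type*} [MeasurableSpace Ω] [Fintype E] [DecidableEq E] [TopologicalSpace E]
  [MeasurableSpace E] {P : Measure Ω} {Q : Matrix E E ℝ} {J : ℝ≥0 → Ω → E}

theorem IsMarkovChain.processHistory_le (hJ : IsMarkovChain P Q J) (s : ℝ≥0) :
    processHistory J s ≤ (inferInstance : MeasurableSpace Ω) :=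
  iSup₂_le fun r _ => (hJ.measurable r).comap_le

variable [MeasurableSingletonClass E] {δ : ℝ≥0} {y : ℕ → E}

theorem IsMarkovChain.measurableSet_gridEvent (hJ : IsMarkovChain P Q J) (n : ℕ) :
    MeasurableSet (gridEvent J δ y n) :=
  hJ.processHistory_le _ _ (measurableSet_processHistory_gridEvent J δ y n)

theorem IsMarkovChain.measure_inter_gridEvent_succ (hJ : IsMarkovChain P Q J) {n : ℕ} {B : Set Ω}
    (hB : MeasurableSet[processHistory J (n * δ)] B) :
    P (B ∩ gridEvent J δ y (n + 1)) = P (B ∩ gridEvent J δ y n) *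
      ENNReal.ofReal (NormedSpace.exp ((δ : ℝ) • Q) (y n) (y (n + 1))) := by
  have hle : (n : ℝ≥0) * δ ≤ (n + 1 : ℕ) * δ := by gcongr; omega
  have h := hJ.markov _ _ hle _ (hB.inter (measurableSet_processHistory_gridEvent J δ y n))
    (y n) (y (n + 1))
  rw [Set.inter_assoc B, gridEvent_inter_preimage, Set.inter_assoc, ← gridEvent_succ] at h
  convert h using 6
  push_cast
  ring

theorem IsMarkovChain.measure_gridEvent_pos (hJ : IsMarkovChain P Q J) (hQ : IsGeneratorMatrix Q)
    (hirr : IsIrreducibleGenerator Q) (hδ : 0 < δ) (hy : 0 < P (J 0 ⁻¹' {y 0})) (n : ℕ) :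
    0 < P (gridEvent J δ y n) := by
  induction n with
  | zero =>
    convert hy using 2
    ext ω
    simp [gridEvent]
  | succ n ih =>
    have h := hJ.measure_inter_gridEvent_succ (δ := δ) (y := y) (n := n) MeasurableSet.univ
    rw [Set.univ_inter, Set.univ_inter] at h
    rw [h]
    exact ENNReal.mul_pos ih.ne' (ENNReal.ofReal_pos.2
      (matrix_exp_smul_apply_pos hQ.offDiag_nonneg hirr (NNReal.coe_pos.2 hδ) _ _)).ne'

theorem IsMarkovChain.le_measure_inter_gridEvent_succ
    (hJ : IsMarkovChain P Q J) {c : ℝ}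
    (hc : ∀ h, 0 ≤ h → ∀ i, Real.exp (-(c * h)) ≤ NormedSpace.exp (h • Q) i i)
    {k : ℕ} (hy : y (k + 1) = y k) {s : ℝ≥0} (hks : k * δ ≤ s) (hsk : s ≤ (k + 1 : ℕ) * δ) :
    ENNReal.ofReal (Real.exp (-(c * δ))) * P (gridEvent J δ y (k + 1))
      ≤ P (J s ⁻¹' {y k} ∩ gridEvent J δ y (k + 1)) := by
  have hgrid := measurableSet_processHistory_gridEvent J δ y k
  have enter := hJ.markov _ _ hks _ hgrid (y k) (y k)
  have leave := hJ.markov _ _ hsk _ (processHistory_mono J hks _ hgrid) (y k) (y k)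
  rw [gridEvent_inter_preimage] at enter
  rw [enter, ← hy, Set.inter_right_comm, ← gridEvent_succ, Set.inter_comm, hy] at leave
  have hc₁ := hc _ (sub_nonneg.2 (NNReal.coe_le_coe.2 hks)) (y k)
  have hc₂ := hc _ (sub_nonneg.2 (NNReal.coe_le_coe.2 hsk)) (y k)
  rw [leave, mul_assoc, ← ENNReal.ofReal_mul ((Real.exp_pos _).le.trans hc₁), mul_comm]
  refine mul_le_mul' (measure_mono ?_) (ENNReal.ofReal_le_ofReal ?_)
  · rw [gridEvent_succ]
    exact Set.inter_subset_left
  · refine le_trans (le_of_eq ?_) (mul_le_mul hc₁ hc₂ (Real.exp_pos _).le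
      ((Real.exp_pos _).le.trans hc₁))
    rw [← Real.exp_add]
    push_cast
    ring_nf

theorem IsMarkovChain.cond_gridEvent_ne_le [IsProbabilityMeasure P] (hJ : IsMarkovChain P Q J)
    (hQ : IsGeneratorMatrix Q) (hirr : IsIrreducibleGenerator Q) {c : ℝ}
    (hc : ∀ h, 0 ≤ h → ∀ i, Real.exp (-(c * h)) ≤ NormedSpace.exp (h • Q) i i)
    (hδ : 0 < δ) (hy0 : 0 < P (J 0 ⁻¹' {y 0})) {k n : ℕ} (hkn : k + 1 ≤ n) (hy : y (k + 1) = y k)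
    {s : ℝ≥0} (hks : k * δ ≤ s) (hsk : s ≤ (k + 1 : ℕ) * δ) :
    P[|gridEvent J δ y n] {ω | J s ω ≠ y k} ≤ ENNReal.ofReal (1 - Real.exp (-(c * δ))) := by
  have hstay : ENNReal.ofReal (Real.exp (-(c * δ))) * P (gridEvent J δ y n)
      ≤ P (J s ⁻¹' {y k} ∩ gridEvent J δ y n) := by
    induction n, hkn using Nat.le_induction with
    | base => exact hJ.le_measure_inter_gridEvent_succ hc hy hks hsk
    | succ n hkn ih =>
      have hB : MeasurableSet[processHistory J (n * δ)] (J s ⁻¹' {y k}) :=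
        measurableSet_processHistory J (hsk.trans (by gcongr)) _
      have h := hJ.measure_inter_gridEvent_succ (δ := δ) (y := y) (n := n) MeasurableSet.univ
      rw [Set.univ_inter, Set.univ_inter] at h
      rw [hJ.measure_inter_gridEvent_succ hB, h, ← mul_assoc]
      gcongr
  have hpos := hJ.measure_gridEvent_pos hQ hirr hδ hy0 n
  have := cond_isProbabilityMeasure hpos.ne'
  have hcond : ENNReal.ofReal (Real.exp (-(c * δ))) ≤ P[|gridEvent J δ y n] (J s ⁻¹' {y k}) := by
    rw [cond_apply (hJ.measurableSet_gridEvent n), Set.inter_comm,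
      ← ENNReal.div_eq_inv_mul]
    exact (ENNReal.le_div_iff_mul_le (.inl hpos.ne') (.inl (measure_ne_top _ _))).2 hstay
  calc P[|gridEvent J δ y n] (J s ⁻¹' {y k})ᶜ
      = 1 - P[|gridEvent J δ y n] (J s ⁻¹' {y k}) :=
        prob_compl_eq_one_sub (hJ.measurable s (measurableSet_singleton _))
    _ ≤ 1 - ENNReal.ofReal (Real.exp (-(c * δ))) := tsub_le_tsub_left hcond _
    _ = ENNReal.ofReal (1 - Real.exp (-(c * δ))) := by
        rw [ENNReal.ofReal_sub _ (Real.exp_pos _).le, ENNReal.ofReal_one]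

/-- `A m` is the event that the chain visits the values of `g` at the points of the grid of mesh
`1 / (m + 1)` (except at time `0`); it is unlikely to jump between two grid points. -/
theorem IsMarkovChain.exists_tendsto_cond_ne [DiscreteTopology E] [IsProbabilityMeasure P]
    (hJ : IsMarkovChain P Q J) (hQ : IsGeneratorMatrix Q) (hirr : IsIrreducibleGenerator Q)
    {g : ℝ≥0 → E} (hg : IsCadlagPath g) (t : ℝ≥0) :
    ∃ A : ℕ → Set Ω, (∀ m, 0 < P (A m)) ∧ ∀ᵐ s ∂volume.restrict (Set.Ioc (0 : ℝ) t),
      Tendsto (fun m => P[|A m] {ω | J s.toNNReal ω ≠ g s.toNNReal}) atTop (𝓝 0) := by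
  obtain ⟨c, hc⟩ := exists_exp_neg_mul_le_matrix_exp_smul_apply hQ.offDiag_nonneg
  obtain ⟨x₀, hx₀⟩ := exists_measure_preimage_singleton_pos P (J 0)
  let δ : ℕ → ℝ≥0 := fun m => 1 / (m + 1)
  let y : ℕ → ℕ → E := fun m k => if k = 0 then x₀ else g (k * δ m)
  have hδ : ∀ m, 0 < δ m := fun m => by positivity
  have hy₀ : ∀ m, 0 < P (J 0 ⁻¹' {y m 0}) := fun m => by simpa only [y, if_true] using hx₀
  refine ⟨fun m => gridEvent J (δ m) (y m) (⌊t * (m + 1)⌋₊ + 1),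
    fun m => hJ.measure_gridEvent_pos hQ hirr (hδ m) (hy₀ m) _, ?_⟩
  have hbound : Tendsto (fun m => ENNReal.ofReal (1 - Real.exp (-(c * δ m)))) atTop (𝓝 0) := by
    have hδ0 : Tendsto (fun m => (δ m : ℝ)) atTop (𝓝 0) := by
      simpa [δ] using tendsto_one_div_add_atTop_nhds_zero_nat (𝕜 := ℝ)
    simpa using ENNReal.tendsto_ofReal (((hδ0.const_mul c).neg.rexp).const_sub 1)
  filter_upwards [ae_restrict_mem measurableSet_Ioc, hg.ae_eventually_eq t] with s hs hconst
  refine tendsto_of_tendsto_of_tendsto_of_le_of_le' tendsto_const_nhds hbound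
    (.of_forall fun _ => zero_le) ?_
  filter_upwards [eventually_grid_eq (Real.toNNReal_pos.2 hs.1) hconst] with m ⟨hk, hg, hg'⟩
  have hy : y m ⌊s.toNNReal * (m + 1)⌋₊ = g s.toNNReal := by simp only [y, if_neg hk, δ, hg]
  have hy' : y m (⌊s.toNNReal * (m + 1)⌋₊ + 1) = g s.toNNReal := by
    simp only [y, Nat.succ_ne_zero, if_false, δ, hg']
  rw [← hy]
  refine hJ.cond_gridEvent_ne_le hQ hirr hc (hδ m) (hy₀ m) ?_ (hy'.trans hy.symm) ?_ ?_
  · gcongr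
    exact Real.toNNReal_le_iff_le_coe.2 hs.2
  · rw [mul_one_div, div_le_iff₀ (by positivity)]
    exact Nat.floor_le zero_le
  · rw [mul_one_div, le_div_iff₀ (by positivity)]
    exact_mod_cast (Nat.lt_floor_add_one _).le

theorem IsMarkovChain.measure_volume_ne_lt_pos [DiscreteTopology E] [IsProbabilityMeasure P]
    (hJ : IsMarkovChain P Q J) (hQ : IsGeneratorMatrix Q) (hirr : IsIrreducibleGenerator Q)
    {g : ℝ≥0 → E} (hg : IsCadlagPath g) (t : ℝ≥0) {ε : ℝ≥0∞} (hε : 0 < ε) :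
    0 < P {ω | volume.restrict (Set.Ioc (0 : ℝ) t) {s | J s.toNNReal ω ≠ g s.toNNReal} < ε} := by
  obtain ⟨A, hA, hlim⟩ := hJ.exists_tendsto_cond_ne hQ hirr hg t
  have : DiscreteMeasurableSpace E := MeasurableSingletonClass.toDiscreteMeasurableSpace
  have hD : MeasurableSet {p : Ω × ℝ | J p.2.toNNReal p.1 ≠ g p.2.toNNReal} :=
    (measurableSet_eq_fun ((measurable_uncurry_of_isCadlagPath hJ.measurable hJ.cadlag).comp
      (measurable_fst.prodMk measurable_snd.real_toNNReal))
      (hg.measurable.comp measurable_snd.real_toNNReal)).compl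
  have hint : Tendsto (fun m => ∫⁻ ω, volume.restrict (Set.Ioc (0 : ℝ) t)
      {s | J s.toNNReal ω ≠ g s.toNNReal} ∂P[|A m]) atTop (𝓝 0) := by
    have fubini : ∀ m, ∫⁻ ω, volume.restrict (Set.Ioc (0 : ℝ) t)
        {s | J s.toNNReal ω ≠ g s.toNNReal} ∂P[|A m] =
        ∫⁻ s in Set.Ioc (0 : ℝ) t, P[|A m] {ω | J s.toNNReal ω ≠ g s.toNNReal} := fun m =>
      (Measure.prod_apply hD).symm.trans (Measure.prod_apply_symm hD)
    simp only [fubini]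
    have h := tendsto_lintegral_of_dominated_convergence (fun _ => 1)
      (fun m => measurable_measure_prodMk_right hD)
      (fun m => .of_forall fun s => prob_le_one) (by simp) hlim
    simpa using h
  by_contra! h
  have ae_ge : ∀ m, ∀ᵐ ω ∂P[|A m],
      ε ≤ volume.restrict (Set.Ioc (0 : ℝ) t) {s | J s.toNNReal ω ≠ g s.toNNReal} := fun m =>
    cond_absolutelyContinuous.ae_le (ae_iff.2 (by simpa only [not_le, nonpos_iff_eq_zero] using h))
  refine hε.not_ge (ge_of_tendsto' hint fun m => ?_)
  have := cond_isProbabilityMeasure (hA m).ne'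
  simpa using lintegral_mono_ae (ae_ge m)

theorem IsMarkovChain.phi_mem_support [DiscreteTopology E] [IsProbabilityMeasure P]
    (hJ : IsMarkovChain P Q J) (hQ : IsGeneratorMatrix Q) (hirr : IsIrreducibleGenerator Q)
    (lam kap mu : E → ℝ≥0) (t : ℝ≥0) {g : ℝ≥0 → E} (hg : IsCadlagPath g) :
    phi lam kap mu t g ∈ (P.map fun ω => phi lam kap mu t fun s => J s ω).support := by
  have : DiscreteMeasurableSpace E := MeasurableSingletonClass.toDiscreteMeasurableSpace
  rw [Metric.nhds_basis_ball.mem_measureSupport]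
  intro ε hε
  rw [Measure.map_apply (measurable_phi
    (measurable_uncurry_of_isCadlagPath hJ.measurable hJ.cadlag) lam kap mu t) measurableSet_ball]
  by_contra! hnull
  have hclose : ∀ m : ℕ, ∃ ω,
      volume.restrict (Set.Ioc (0 : ℝ) t) {s | J s.toNNReal ω ≠ g s.toNNReal} < 2⁻¹ ^ m ∧
      phi lam kap mu t (fun s => J s ω) ∉ Metric.ball (phi lam kap mu t g) ε := fun m =>
    ((frequently_ae_iff.2 (hJ.measure_volume_ne_lt_pos hQ hirr hg t
      (ENNReal.pow_pos (by simp) m)).ne').and_eventually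
      (measure_eq_zero_iff_ae_notMem.1 (nonpos_iff_eq_zero.1 hnull))).exists
  choose ω hω hfar using hclose
  have hsum : ∑' m, volume.restrict (Set.Ioc (0 : ℝ) t)
      {s | J s.toNNReal (ω m) ≠ g s.toNNReal} ≠ ∞ :=
    ne_top_of_le_ne_top (by simp) (ENNReal.tsum_le_tsum fun m => (hω m).le)
  have hlim := tendsto_phi lam kap mu (fun m => (hJ.cadlag (ω m)).measurable) (f₀ := g) (t := t)
    ((ae_eventually_notMem hsum).mono fun s hs => hs.mono fun m hm => not_not.1 hm)
  obtain ⟨m, hm⟩ := (hlim.eventually (Metric.ball_mem_nhds _ hε)).exists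
  exact hfar m hm

theorem IsMarkovChain.support_map_phi [DiscreteTopology E] [IsProbabilityMeasure P]
    (hJ : IsMarkovChain P Q J) (hQ : IsGeneratorMatrix Q) (hirr : IsIrreducibleGenerator Q)
    (lam kap mu : E → ℝ≥0) (t : ℝ≥0) {p q : ℝ}
    (hp : IsGLB (phi lam kap mu t '' {g | IsCadlagPath g}) p)
    (hq : IsLUB (phi lam kap mu t '' {g | IsCadlagPath g}) q) :
    (P.map fun ω => phi lam kap mu t fun s => J s ω).support = Set.Icc p q := by
  have : DiscreteMeasurableSpace E := MeasurableSingletonClass.toDiscreteMeasurableSpace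
  have himage : phi lam kap mu t '' {g | IsCadlagPath g}
      ⊆ (P.map fun ω => phi lam kap mu t fun s => J s ω).support :=
    Set.image_subset_iff.2 fun g hg => hJ.phi_mem_support hQ hirr lam kap mu t hg
  obtain ⟨ω⟩ := nonempty_of_isProbabilityMeasure P
  have hne : (phi lam kap mu t '' {g | IsCadlagPath g}).Nonempty := ⟨_, _, hJ.cadlag ω, rfl⟩
  refine Set.Subset.antisymm (Measure.support_subset_of_isClosed isClosed_Icc ?_) fun a ha => ?_
  · have hm := measurable_phi (measurable_uncurry_of_isCadlagPath hJ.measurable hJ.cadlag)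
      lam kap mu t
    exact (mem_ae_map_iff hm.aemeasurable measurableSet_Icc).2 (Eventually.of_forall fun ω =>
      ⟨hp.1 ⟨_, hJ.cadlag ω, rfl⟩, hq.1 ⟨_, hJ.cadlag ω, rfl⟩⟩)
  · refine closure_minimal himage Measure.isClosed_support ?_
    rcases ha.1.eq_or_lt with rfl | hpa
    · exact hp.mem_closure hne
    rcases ha.2.eq_or_lt with rfl | haq
    · exact hq.mem_closure hne
    obtain ⟨b, hb, -, hba⟩ := hp.exists_between hpa
    obtain ⟨b', hb', hab', -⟩ := hq.exists_between haq
    exact subset_closure ((ordConnected_phi_image lam kap mu t).out hb hb' ⟨hba.le, hab'.le⟩)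

end Markov

theorem attainableSet_const (ν : Measure ℝ) :
    attainableSet (fun _ => ν) = Set.Ici 0 ∩ ν.support := by
  ext γ
  rw [Set.mem_inter_iff, Metric.nhds_basis_ball.mem_measureSupport]
  exact and_congr_right fun _ => forall₂_congr fun ε _ =>
    ⟨fun ⟨N, hN⟩ => hN N le_rfl, fun h => ⟨0, fun _ _ => h⟩⟩

/-! ### The time change from clock time to real time -/

/-- The time at which the clock `s ↦ ∫_0^s λ(f(r)) dr` first reaches `u`, and `∞` if it never
does. A job arriving with the jump of the driving Poisson process at clock time `u` enters the queue
at this time. -/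
noncomputable def hitTime {E : Type*} (lam : E → ℝ≥0) (f : ℝ≥0 → E) (u : ℝ) : ℝ≥0∞ :=
  ⨅ (s : ℝ≥0) (_ : u ≤ pathIntegral lam f 0 s), (s : ℝ≥0∞)

theorem arrivalTime_eq_hitTime {E : Type*} (lam : E → ℝ≥0) (f : ℝ≥0 → E) (σ : ℕ → ℝ) (k : ℕ) :
    arrivalTime lam f σ k = hitTime lam f (baseArrival σ k) :=
  rfl

section TimeChange

variable {E : Type*} [Finite E] [MeasurableSpace E] [DiscreteMeasurableSpace E]

theorem hitTime_le_iff (lam : E → ℝ≥0) {f : ℝ≥0 → E} (hf : Measurable f) {u : ℝ} {a : ℝ≥0} :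
    hitTime lam f u ≤ a ↔ u ≤ pathIntegral lam f 0 a := by
  refine ⟨fun h => ?_, fun h => iInf₂_le a h⟩
  by_contra! hlt
  obtain ⟨b, hab, hb⟩ := mem_nhdsGE_iff_exists_Icc_subset.1 (mem_nhdsWithin_of_mem_nhds
    ((continuous_pathIntegral lam hf).continuousAt.eventually_lt_const hlt))
  have clock_b_lt : pathIntegral lam f 0 b < u := hb ⟨hab.le, le_rfl⟩
  have le_hitTime : (b : ℝ≥0∞) ≤ hitTime lam f u := le_iInf₂ fun s hs => by
    by_contra! hsb
    exact (hs.trans (monotone_pathIntegral lam hf (ENNReal.coe_le_coe.1 hsb.le))).not_gt clock_b_lt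
  exact (ENNReal.coe_lt_coe.2 hab).not_ge (le_hitTime.trans h)

theorem toNNReal_hitTime_le_iff (lam : E → ℝ≥0) {f : ℝ≥0 → E} (hf : Measurable f) {t : ℝ≥0} {u : ℝ}
    (hu : u ≤ pathIntegral lam f 0 t) {a : ℝ≥0} :
    (hitTime lam f u).toNNReal ≤ a ↔ u ≤ pathIntegral lam f 0 a := by
  have finite : hitTime lam f u ≠ ⊤ :=
    ne_top_of_le_ne_top ENNReal.coe_ne_top ((hitTime_le_iff lam hf).2 hu)
  rw [← hitTime_le_iff lam hf, ← ENNReal.coe_le_coe, ENNReal.coe_toNNReal finite]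

theorem measurable_hitTime_uncurry {S : Type*} [MeasurableSpace S] {J : ℝ≥0 → S → E}
    (hJ : Measurable fun p : S × ℝ≥0 => J p.2 p.1) (lam : E → ℝ≥0) :
    Measurable fun p : S × ℝ => hitTime lam (fun s => J s p.1) p.2 := by
  refine measurable_of_Iic fun a => ?_
  induction a with
  | top => simp
  | coe a =>
    have preimage_eq : (fun p : S × ℝ => hitTime lam (fun s => J s p.1) p.2) ⁻¹' Set.Iic ↑a
        = {p | p.2 ≤ pathIntegral lam (fun s => J s p.1) 0 a} := by
      ext p
      exact hitTime_le_iff lam (hJ.comp (measurable_const.prodMk measurable_id))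
    rw [preimage_eq]
    exact measurableSet_le measurable_snd ((measurable_pathIntegral_uncurry hJ lam).comp
      (measurable_fst.prodMk measurable_const))

theorem measurable_hitTime (lam : E → ℝ≥0) {f : ℝ≥0 → E} (hf : Measurable f) :
    Measurable (hitTime lam f) :=
  (measurable_hitTime_uncurry (J := fun s (_ : Unit) => f s) (hf.comp measurable_snd) lam).comp
    (measurable_const.prodMk measurable_id : Measurable fun u : ℝ => ((), u))

theorem map_toNNReal_hitTime (lam : E → ℝ≥0) {f : ℝ≥0 → E} (hf : Measurable f) (t : ℝ≥0) :
    (volume.restrict (Set.Ioc 0 (pathIntegral lam f 0 t))).map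
        (fun u => (hitTime lam f u).toNNReal)
      = ((volume.restrict (Set.Ioc (0 : ℝ) t)).withDensity
          fun s => (lam (f s.toNNReal) : ℝ≥0∞)).map Real.toNNReal := by
  have hτ : Measurable fun u => (hitTime lam f u).toNNReal :=
    (measurable_hitTime lam hf).ennreal_toNNReal
  refine Measure.ext_of_Iic _ _ fun a => ?_
  have hit_before : (fun u => (hitTime lam f u).toNNReal) ⁻¹' Set.Iic a
      ∩ Set.Ioc 0 (pathIntegral lam f 0 t) = Set.Ioc 0 (pathIntegral lam f 0 (min a t)) := by
    ext u
    simp only [(monotone_pathIntegral lam hf).map_min, Set.mem_inter_iff, Set.mem_preimage,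
      Set.mem_Iic, Set.mem_Ioc, le_min_iff]
    exact ⟨fun ⟨ha, h0, ht⟩ => ⟨h0, (toNNReal_hitTime_le_iff lam hf ht).1 ha, ht⟩,
      fun ⟨h0, ha, ht⟩ => ⟨(toNNReal_hitTime_le_iff lam hf ht).2 ha, h0, ht⟩⟩
  have time_before : Real.toNNReal ⁻¹' Set.Iic a ∩ Set.Ioc (0 : ℝ) t
      = Set.Ioc (0 : ℝ) (min a t : ℝ≥0) := by
    ext s
    simp only [Set.mem_inter_iff, Set.mem_preimage, Set.mem_Iic, Set.mem_Ioc, NNReal.coe_min,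
      le_min_iff, Real.toNNReal_le_iff_le_coe]
    tauto
  have rate_integrable := (intervalIntegrable_iff_integrableOn_Ioc_of_le (NNReal.coe_nonneg _)).1
    (intervalIntegrable_rate_comp lam hf 0 (min a t : ℝ≥0))
  rw [Measure.map_apply hτ measurableSet_Iic, Measure.restrict_apply (hτ measurableSet_Iic),
    hit_before, Real.volume_Ioc, sub_zero, Measure.map_apply measurable_real_toNNReal
    measurableSet_Iic, withDensity_apply _ (measurable_real_toNNReal measurableSet_Iic),
    Measure.restrict_restrict (measurable_real_toNNReal measurableSet_Iic), time_before,
    pathIntegral, NNReal.coe_zero, intervalIntegral.integral_of_le (NNReal.coe_nonneg _),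
    ofReal_integral_eq_lintegral_ofReal rate_integrable
      (Eventually.of_forall fun _ => NNReal.coe_nonneg _)]
  simp only [ENNReal.ofReal_coe_nnreal]

theorem integral_comp_hitTime (lam : E → ℝ≥0) {f : ℝ≥0 → E} (hf : Measurable f) (t : ℝ≥0)
    {ψ : ℝ≥0 → ℝ} (hψ : Measurable ψ) :
    ∫ u in (0 : ℝ)..pathIntegral lam f 0 t, ψ (hitTime lam f u).toNNReal
      = ∫ s in (0 : ℝ)..t, (lam (f s.toNNReal) : ℝ) * ψ s.toNNReal := by
  rw [intervalIntegral.integral_of_le (pathIntegral_nonneg lam f zero_le),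
    intervalIntegral.integral_of_le t.coe_nonneg,
    ← integral_map (measurable_hitTime lam hf).ennreal_toNNReal.aemeasurable
      hψ.aestronglyMeasurable,
    map_toNNReal_hitTime lam hf t,
    integral_map measurable_real_toNNReal.aemeasurable hψ.aestronglyMeasurable,
    integral_withDensity_eq_integral_smul (f := fun s : ℝ => lam (f s.toNNReal))
      (Measurable.of_discrete.comp (hf.comp measurable_real_toNNReal))]
  rfl

end TimeChange

/-! ### The jobs present, in terms of clock times -/

/-- A job arriving at clock time `u` is still present at time `t` if and only if its mark (its
service requirement before modulation) exceeds this level. Only meaningful if the clock reaches `u`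
by time `t`. -/
noncomputable def markThreshold {E : Type*} (lam kap mu : E → ℝ≥0) (f : ℝ≥0 → E) (t : ℝ≥0)
    (u : ℝ) : ℝ :=
  (kap (f (hitTime lam f u).toNNReal) : ℝ) * pathIntegral mu f (hitTime lam f u).toNNReal t

section JobsPresent

variable {E : Type*} [Finite E] [MeasurableSpace E] [DiscreteMeasurableSpace E]

theorem markThreshold_nonneg (lam kap mu : E → ℝ≥0) {f : ℝ≥0 → E} (hf : Measurable f) {t : ℝ≥0}
    {u : ℝ} (hu : u ≤ pathIntegral lam f 0 t) : 0 ≤ markThreshold lam kap mu f t u :=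
  mul_nonneg (NNReal.coe_nonneg _)
    (pathIntegral_nonneg mu f ((toNNReal_hitTime_le_iff lam hf hu).2 hu))

theorem measurable_kap_mul_pathIntegral (kap mu : E → ℝ≥0) {f : ℝ≥0 → E} (hf : Measurable f)
    (t : ℝ≥0) : Measurable fun s : ℝ≥0 => (kap (f s) : ℝ) * pathIntegral mu f s t := by
  rw [funext fun s : ℝ≥0 => congrArg ((kap (f s) : ℝ) * ·) (pathIntegral_eq_sub mu hf s t)]
  exact (Measurable.of_discrete.comp hf).coe_nnreal_real.mul
    (measurable_const.sub (continuous_pathIntegral mu hf).measurable)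

theorem measurable_markThreshold (lam kap mu : E → ℝ≥0) {f : ℝ≥0 → E} (hf : Measurable f)
    (t : ℝ≥0) : Measurable (markThreshold lam kap mu f t) :=
  (measurable_kap_mul_pathIntegral kap mu hf t).comp (measurable_hitTime lam hf).ennreal_toNNReal

theorem integral_exp_neg_markThreshold (lam kap mu : E → ℝ≥0) {f : ℝ≥0 → E} (hf : Measurable f)
    (t : ℝ≥0) :
    ∫ u in (0 : ℝ)..pathIntegral lam f 0 t, Real.exp (-markThreshold lam kap mu f t u)
      = phi lam kap mu t f := by
  simp only [phi, neg_mul]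
  exact integral_comp_hitTime lam hf t (measurable_kap_mul_pathIntegral kap mu hf t).neg.exp

theorem mem_jobsPresent_iff (lam kap mu : E → ℝ≥0) {f : ℝ≥0 → E} (hf : Measurable f)
    (t : ℝ≥0) {σ z : ℕ → ℝ} {k : ℕ} (hz : 0 < z k) :
    k ∈ jobsPresent lam kap mu f σ z t ↔ baseArrival σ k ≤ pathIntegral lam f 0 t ∧
      markThreshold lam kap mu f t (baseArrival σ k) < z k := by
  simp only [jobsPresent, Set.mem_ofPred_eq, arrivalTime_eq_hitTime, hitTime_le_iff lam hf]
  refine and_congr_right fun hle => ?_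
  have work_nonneg : 0 ≤ pathIntegral mu f (hitTime lam f (baseArrival σ k)).toNNReal t :=
    pathIntegral_nonneg mu f ((toNNReal_hitTime_le_iff lam hf hle).2 hle)
  unfold serviceRequirement markThreshold
  split_ifs with hkap
  · rw [ENNReal.ofReal_le_ofReal_iff work_nonneg, not_le, lt_div_iff₀ (by exact_mod_cast hkap),
      mul_comm]
  · simpa [nonpos_iff_eq_zero.1 (not_lt.1 hkap)] using hz

theorem measurable_numJobs_uncurry {S : Type*} [MeasurableSpace S] {J : ℝ≥0 → S → E}
    (hJ : Measurable fun p : S × ℝ≥0 => J p.2 p.1) (lam kap mu : E → ℝ≥0) (t : ℝ≥0) :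
    Measurable fun p : S × ((ℕ → ℝ) × (ℕ → ℝ)) =>
      numJobs lam kap mu (fun s => J s p.1) p.2.1 p.2.2 t := by
  refine measurable_ncard.comp (measurable_set_iff.2 fun k => ?_)
  have arrival : Measurable fun p : S × ((ℕ → ℝ) × (ℕ → ℝ)) =>
      arrivalTime lam (fun s => J s p.1) p.2.1 k := by
    have clock_time : Measurable fun p : S × ((ℕ → ℝ) × (ℕ → ℝ)) => baseArrival p.2.1 k := by
      unfold baseArrival
      fun_prop
    exact ((measurable_hitTime_uncurry hJ lam).comp (measurable_fst.prodMk clock_time) :)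
  have point : Measurable fun p : S × ((ℕ → ℝ) × (ℕ → ℝ)) =>
      (p.1, (arrivalTime lam (fun s => J s p.1) p.2.1 k).toNNReal) :=
    measurable_fst.prodMk arrival.ennreal_toNNReal
  have rate : Measurable fun p : S × ((ℕ → ℝ) × (ℕ → ℝ)) =>
      kap (J (arrivalTime lam (fun s => J s p.1) p.2.1 k).toNNReal p.1) :=
    Measurable.of_discrete.comp (hJ.comp point)
  have requirement : Measurable fun p : S × ((ℕ → ℝ) × (ℕ → ℝ)) => serviceRequirement kap
      (J (arrivalTime lam (fun s => J s p.1) p.2.1 k).toNNReal p.1) (p.2.2 k) :=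
    Measurable.ite (measurableSet_lt measurable_const rate)
      (Measurable.ennreal_ofReal (Measurable.div (by fun_prop) rate.coe_nnreal_real))
      measurable_const
  exact (measurableSet_le arrival measurable_const).mem.and (measurableSet_le requirement
    ((measurable_pathIntegral_uncurry_left hJ mu t).comp point).ennreal_ofReal).mem.not

end JobsPresent

/-! ### Exponentials of primitives -/

section ExpPrimitive

theorem integral_eq_sub_of_absolutelyContinuousOnInterval {F : Type*} [NormedAddCommGroup F]
    [NormedSpace ℝ F] [CompleteSpace F] {f f' : ℝ → F} {a b C : ℝ}
    (hf : AbsolutelyContinuousOnInterval f a b)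
    (hderiv : ∀ᵐ x, x ∈ Set.uIcc a b → HasDerivAt f (f' x) x)
    (hf' : IntervalIntegrable f' volume a b) (hC : ∀ x ∈ Set.uIcc a b, ‖f' x‖ ≤ C) :
    ∫ x in a..b, f' x = f b - f a := by
  have hint : ∀ x ∈ Set.uIcc a b, IntervalIntegrable f' volume a x := fun x hx =>
    hf'.mono_set (Set.uIcc_subset_uIcc_left hx)
  have primitive_ac : AbsolutelyContinuousOnInterval (fun x => ∫ v in a..x, f' v) a b := by
    refine LipschitzOnWith.absolutelyContinuousOnInterval (K := C.toNNReal)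
      (LipschitzOnWith.of_dist_le_mul fun x hx y hy => ?_)
    rw [dist_eq_norm, intervalIntegral.integral_interval_sub_left (hint x hx) (hint y hy),
      Real.dist_eq]
    exact intervalIntegral.norm_integral_le_of_norm_le_const fun v hv =>
      (hC v (Set.uIcc_subset_uIcc hy hx (Set.uIoc_subset_uIcc hv))).trans (Real.le_coe_toNNReal C)
  obtain ⟨const, hconst⟩ := (hf.sub primitive_ac).const_of_ae_hasDerivAt_zero (by
    filter_upwards [hderiv, hf'.ae_hasDerivAt_integral] with x hx hx' hmem
    simpa using! (hx hmem).sub (hx' hmem a Set.left_mem_uIcc))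
  have at_left := hconst a Set.left_mem_uIcc
  have at_right := hconst b Set.right_mem_uIcc
  simp only [Pi.sub_apply, intervalIntegral.integral_same, sub_zero] at at_left at_right
  rw [at_left, ← at_right, sub_sub_cancel]

variable {b : ℝ → ℂ} {C : ℝ}

theorem locallyIntegrable_of_norm_le {F : Type*} [NormedAddCommGroup F] {f : ℝ → F} {C : ℝ}
    (hf : AEStronglyMeasurable f) (hC : ∀ v, ‖f v‖ ≤ C) : LocallyIntegrable f :=
  (locallyIntegrable_const C).mono hf
    (.of_forall fun v => (hC v).trans (Real.le_norm_self C))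

theorem intervalIntegrable_of_norm_le {F : Type*} [NormedAddCommGroup F] {f : ℝ → F} {C : ℝ}
    (hf : AEStronglyMeasurable f) (hC : ∀ v, ‖f v‖ ≤ C) (u v : ℝ) :
    IntervalIntegrable f volume u v :=
  ((locallyIntegrable_of_norm_le hf hC).integrableOn_isCompact isCompact_uIcc).intervalIntegrable

theorem lipschitzWith_integral_of_norm_le {F : Type*} [NormedAddCommGroup F] [NormedSpace ℝ F]
    {f : ℝ → F} {C : ℝ≥0} (hf : AEStronglyMeasurable f) (hC : ∀ v, ‖f v‖ ≤ C) (a : ℝ) :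
    LipschitzWith C fun v => ∫ w in a..v, f w := by
  refine LipschitzWith.of_dist_le_mul fun x y => ?_
  have hint := intervalIntegrable_of_norm_le hf hC
  rw [dist_eq_norm, intervalIntegral.integral_interval_sub_left (hint _ _) (hint _ _), Real.dist_eq]
  exact intervalIntegral.norm_integral_le_of_norm_le_const fun v _ => hC v

theorem absolutelyContinuousOnInterval_cexp {f : ℝ → ℂ} {K : ℝ≥0} (hf : LipschitzWith K f)
    (u v : ℝ) : AbsolutelyContinuousOnInterval (fun x => Complex.exp (f x)) u v := by
  obtain ⟨R, hR⟩ := isCompact_uIcc.exists_bound_of_continuousOn (s := Set.uIcc u v)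
    hf.continuous.continuousOn
  obtain ⟨K', hK'⟩ := (Complex.contDiff_exp (n := 1) (𝕜 := ℝ)).contDiffOn.exists_lipschitzOnWith
    (by decide) (convex_closedBall (0 : ℂ) R) (isCompact_closedBall _ _)
  exact (hK'.comp hf.lipschitzOnWith fun x hx => by simpa using hR x hx
    : LipschitzOnWith _ _ (Set.uIcc u v)).absolutelyContinuousOnInterval

theorem integral_mul_exp_neg_primitive (hb : AEStronglyMeasurable b) (hC : ∀ v, ‖b v‖ ≤ C)
    (a u v : ℝ) :
    ∫ x in u..v, b x * Complex.exp (-∫ w in a..x, b w)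
      = Complex.exp (-∫ w in a..u, b w) - Complex.exp (-∫ w in a..v, b w) := by
  have hC' : ∀ x, ‖b x‖ ≤ C.toNNReal := fun x => (hC x).trans (Real.le_coe_toNNReal C)
  have lipschitz := (lipschitzWith_integral_of_norm_le hb hC' a).neg
  have exp_continuous := Complex.continuous_exp.comp lipschitz.continuous
  obtain ⟨R, hR⟩ := isCompact_uIcc.exists_bound_of_continuousOn (s := Set.uIcc u v)
    exp_continuous.continuousOn
  have deriv : ∀ᵐ x, x ∈ Set.uIcc u v → HasDerivAt (fun x => -Complex.exp (-∫ w in a..x, b w))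
      (b x * Complex.exp (-∫ w in a..x, b w)) x := by
    filter_upwards [LocallyIntegrable.ae_hasDerivAt_integral
      (locallyIntegrable_of_norm_le hb hC)] with x hx _
    exact (hx a).neg.cexp.neg.congr_deriv (by simp [mul_comm])
  rw [integral_eq_sub_of_absolutelyContinuousOnInterval (C := C * R)
    (absolutelyContinuousOnInterval_cexp lipschitz u v).neg deriv
    ((intervalIntegrable_of_norm_le hb hC u v).mul_continuousOn exp_continuous.continuousOn)]
  · simp only [Pi.neg_apply]
    ring
  · intro x hx
    rw [norm_mul]
    exact mul_le_mul (hC x) (hR x hx) (norm_nonneg _) ((norm_nonneg _).trans (hC x))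

end ExpPrimitive

/-! ### Exponential waiting times -/

section Exponential

theorem integral_expMeasure {F : Type*} [NormedAddCommGroup F] [NormedSpace ℝ F] {r : ℝ}
    (hr : 0 ≤ r) (f : ℝ → F) :
    ∫ x, f x ∂expMeasure r = ∫ x in Set.Ioi (0 : ℝ), (r * Real.exp (-(r * x))) • f x := by
  have measurable_pdf : Measurable (exponentialPDF r) :=
    (measurable_exponentialPDFReal r).ennreal_ofReal
  rw [show expMeasure r = volume.withDensity (exponentialPDF r) from rfl,
    integral_withDensity_eq_integral_toReal_smul measurable_pdf
      (.of_forall fun _ => ENNReal.ofReal_lt_top),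
    ← integral_Ici_eq_integral_Ioi, ← integral_indicator measurableSet_Ici]
  congr with x
  rcases lt_or_ge x 0 with hx | hx
  · simp [exponentialPDF_of_neg hx, hx]
  · rw [exponentialPDF_of_nonneg hx, Set.indicator_of_mem (Set.mem_Ici.2 hx),
      ENNReal.toReal_ofReal (mul_nonneg hr (Real.exp_pos (-(r * x))).le)]

theorem measureReal_Ioi_expMeasure {r : ℝ} (hr : 0 < r) {a : ℝ} (ha : 0 ≤ a) :
    (expMeasure r).real (Set.Ioi a) = Real.exp (-(r * a)) := by
  have := isProbabilityMeasure_expMeasure hr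
  rw [← Set.compl_Iic, probReal_compl_eq_one_sub measurableSet_Iic, ← cdf_eq_real,
    cdf_expMeasure_eq hr, if_pos ha, sub_sub_cancel]

theorem ae_pos_expMeasure {r : ℝ} (hr : 0 < r) : ∀ᵐ x ∂expMeasure r, 0 < x := by
  have := isProbabilityMeasure_expMeasure hr
  have measure_Iic : (expMeasure r).real (Set.Iic 0) = 0 := by
    simp [← cdf_eq_real, cdf_expMeasure_eq hr]
  filter_upwards [measure_eq_zero_iff_ae_notMem.1 ((measureReal_eq_zero_iff).1 measure_Iic)]
    with x hx using not_le.1 hx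

theorem norm_exp_neg_primitive_le {c : ℝ → ℂ} (hc : Integrable c) (u : ℝ) :
    ‖Complex.exp (-∫ w in 0..u, c w)‖ ≤ Real.exp (∫ w, ‖c w‖) := by
  refine (Complex.norm_exp_le_exp_norm _).trans (Real.exp_le_exp.2 ?_)
  rw [norm_neg]
  exact intervalIntegral.norm_integral_le_integral_norm_uIoc.trans
    (setIntegral_le_integral hc.norm (.of_forall fun _ => norm_nonneg _))

theorem continuous_exp_neg_primitive {c : ℝ → ℂ} (hc : Integrable c) :
    Continuous fun u => Complex.exp (-∫ w in 0..u, c w) :=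
  Complex.continuous_exp.comp (intervalIntegral.continuous_primitive
    (fun _ _ => hc.intervalIntegrable) 0).neg

theorem intervalIntegral_exp_neg_mul_exp_neg_primitive {c : ℝ → ℂ} {C : ℝ} (hc : Integrable c)
    (hC : ∀ v, ‖1 + c v‖ ≤ C) (u R : ℝ) :
    ∫ x in 0..R, Real.exp (-x) • ((1 + c (u + x)) * Complex.exp (-∫ w in 0..(u + x), c w))
      = Complex.exp (-∫ w in 0..u, c w)
        - Real.exp (-R) * Complex.exp (-∫ w in 0..(u + R), c w) := by
  have split_exp (v : ℝ) : Complex.exp (-∫ w in 0..v, 1 + c w)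
      = Real.exp (-v) * Complex.exp (-∫ w in 0..v, c w) := by
    rw [intervalIntegral.integral_add intervalIntegrable_const hc.intervalIntegrable, neg_add,
      Complex.exp_add]
    simp
  have clock := integral_mul_exp_neg_primitive (b := fun v => 1 + c v)
    (aestronglyMeasurable_const.add hc.aestronglyMeasurable) hC 0 u (u + R)
  simp only [split_exp] at clock
  have shift := intervalIntegral.integral_comp_add_left (a := 0) (b := R)
    (fun v => (1 + c v) * (Real.exp (-v) * Complex.exp (-∫ w in 0..v, c w))) u
  rw [add_zero, clock] at shift
  have factor (x : ℝ) (y z : ℂ) :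
      Real.exp (-x) • (y * z) = Real.exp u * (y * (Real.exp (-(u + x)) * z)) := by
    rw [show -x = u + -(u + x) by ring, Real.exp_add, Complex.real_smul]
    push_cast
    ring
  simp only [factor]
  rw [intervalIntegral.integral_const_mul, shift, mul_sub, ← mul_assoc, ← mul_assoc,
    ← Complex.ofReal_mul, ← Complex.ofReal_mul, ← Real.exp_add, ← Real.exp_add]
  simp

theorem integral_expMeasure_mul_exp_neg_primitive {c : ℝ → ℂ} {C : ℝ} (hc : Integrable c)
    (hC : ∀ v, ‖1 + c v‖ ≤ C) (u : ℝ) :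
    ∫ x, (1 + c (u + x)) * Complex.exp (-∫ w in 0..(u + x), c w) ∂expMeasure 1
      = Complex.exp (-∫ w in 0..u, c w) := by
  have G_continuous := continuous_exp_neg_primitive hc
  have G_bounded := norm_exp_neg_primitive_le hc
  have integrable : IntegrableOn (fun x => Real.exp (-x) •
      ((1 + c (u + x)) * Complex.exp (-∫ w in 0..(u + x), c w))) (Set.Ioi 0) := by
    refine (integrableOn_exp_neg_Ioi 0).smul_bdd (C * Real.exp (∫ w, ‖c w‖)) ?_
      (.of_forall fun x => ?_)
    · exact (((aestronglyMeasurable_const.add hc.aestronglyMeasurable).mul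
        G_continuous.aestronglyMeasurable).comp_measurePreserving
        (measurePreserving_add_left volume u)).restrict
    · rw [norm_mul]
      exact mul_le_mul (hC _) (G_bounded _) (norm_nonneg _) ((norm_nonneg _).trans (hC 0))
  have remainder : Tendsto (fun R : ℝ => (Real.exp (-R) : ℂ) *
      Complex.exp (-∫ w in 0..(u + R), c w)) atTop (𝓝 0) := by
    refine squeeze_zero_norm (a := fun R => Real.exp (-R) * Real.exp (∫ w, ‖c w‖)) (fun R => ?_) ?_
    · rw [norm_mul, Complex.norm_real, Real.norm_of_nonneg (Real.exp_pos _).le]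
      exact mul_le_mul_of_nonneg_left (G_bounded _) (Real.exp_pos _).le
    · simpa using Real.tendsto_exp_neg_atTop_nhds_zero.mul_const _
  rw [integral_expMeasure zero_le_one]
  simp only [one_mul]
  refine tendsto_nhds_unique
    (intervalIntegral_tendsto_integral_Ioi 0 integrable tendsto_id) ?_
  simp only [id, intervalIntegral_exp_neg_mul_exp_neg_primitive hc hC]
  simpa only [sub_zero] using remainder.const_sub (Complex.exp (-∫ w in 0..u, c w))

end Exponential

/-! ### Campbell's formula for a marked Poisson process -/

section Campbell

variable {Ω : Type*} [MeasurableSpace Ω] {P : Measure Ω}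

theorem indepFun_of_dependsOn {ι β S S' : Type*} [Nonempty β] [MeasurableSpace β]
    [MeasurableSpace S] [MeasurableSpace S'] {W : ι → Ω → β} (hW : iIndepFun W P)
    (hm : ∀ i, AEMeasurable (W i) P) {A B : Finset ι} (hAB : Disjoint A B)
    {φ : (ι → β) → S} {ψ : (ι → β) → S'} (hφ : Measurable φ) (hψ : Measurable ψ)
    (hφA : DependsOn φ A) (hψB : DependsOn ψ B) :
    IndepFun (fun ω => φ fun i => W i ω) (fun ω => ψ fun i => W i ω) P := by
  classical
  let w₀ : ι → β := fun _ => Classical.arbitrary β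
  have restrict_eqOn (C : Finset ι) (w : ι → β) :
      ∀ i ∈ (C : Set ι), w i = Function.updateFinset w₀ C (C.restrict w) i := fun i hi => by
    simp [Function.updateFinset, Finset.mem_coe.1 hi]
  have := (hW.indepFun_finset₀ A B hAB hm).comp
    (hφ.comp (measurable_updateFinset (x := w₀) (s := A)))
    (hψ.comp (measurable_updateFinset (x := w₀) (s := B)))
  convert this using 2 with ω ω
  exacts [hφA (restrict_eqOn A _), hψB (restrict_eqOn B _)]

theorem integral_comp_prodMk_of_indepFun {S T F : Type*} [MeasurableSpace S] [MeasurableSpace T]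
    [NormedAddCommGroup F] [NormedSpace ℝ F] [IsFiniteMeasure P]
    {Z : Ω → S} {W : Ω → T} {ρ : Measure T} [SFinite ρ] (hZ : AEMeasurable Z P) (hW : HasLaw W ρ P)
    (hZW : IndepFun Z W P) {Φ : S × T → F} (hΦ : AEStronglyMeasurable Φ ((P.map Z).prod ρ))
    (hint : Integrable (fun ω => Φ (Z ω, W ω)) P) :
    ∫ ω, Φ (Z ω, W ω) ∂P = ∫ ω, ∫ w, Φ (Z ω, w) ∂ρ ∂P := by
  have hpair := hZ.prodMk hW.aemeasurable
  have law_pair : P.map (fun ω => (Z ω, W ω)) = (P.map Z).prod ρ := by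
    rw [hZW.map_prod_eq_prod_map_map hZ hW.aemeasurable, hW.map_eq]
  rw [← law_pair] at hΦ
  have hint' := (integrable_map_measure hΦ hpair).2 hint
  rw [← integral_map hpair hΦ]
  rw [law_pair] at hΦ hint' ⊢
  rw [integral_prod _ hint', integral_map hZ hΦ.integral_prod_right']

theorem ae_tendsto_sum_range_atTop_of_pos [IsProbabilityMeasure P] {X : ℕ → Ω → ℝ}
    (hX : Pairwise fun i j => IndepFun (X i) (X j) P)
    (hident : ∀ k, IdentDistrib (X k) (X 0) P P) (hpos : ∀ᵐ ω ∂P, 0 < X 0 ω) :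
    ∀ᵐ ω ∂P, Tendsto (fun n => ∑ i ∈ Finset.range n, X i ω) atTop atTop := by
  let τ : ℝ → ℝ := fun x => max 0 (min x 1)
  have hτ : Measurable τ := by fun_prop
  have hint : Integrable (fun ω => τ (X 0 ω)) P :=
    .of_bound (hτ.comp_aemeasurable (hident 0).aemeasurable_fst).aestronglyMeasurable 1
      (Eventually.of_forall fun ω => by
        rw [Real.norm_of_nonneg (le_max_left _ _)]; exact max_le zero_le_one (min_le_right _ _))
  have mean_pos : 0 < ∫ ω, τ (X 0 ω) ∂P := by
    refine (integral_nonneg fun ω => le_max_left _ _).lt_of_ne' fun h => ?_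
    rw [integral_eq_zero_iff_of_nonneg (fun ω => le_max_left _ _) hint] at h
    obtain ⟨ω, hω, hω'⟩ := (h.and hpos).exists
    exact hω.not_gt (lt_max_of_lt_right (lt_min hω' one_pos))
  filter_upwards [strong_law_ae_real (fun k ω => τ (X k ω)) hint
    (fun i j hij => (hX hij).comp hτ hτ) (fun k => (hident k).comp hτ),
    ae_all_iff.2 fun k => ((hident k).symm.ae_snd measurableSet_Ioi) hpos] with ω hslln hω
  have := hslln.pos_mul_atTop mean_pos tendsto_natCast_atTop_atTop
  refine tendsto_atTop_mono' _ ?_ this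
  filter_upwards [eventually_ne_atTop 0] with n hn
  rw [div_mul_cancel₀ _ (by positivity)]
  refine Finset.sum_le_sum fun i _ => max_le (hω i).le (min_le_left _ _)

theorem ae_pos_of_hasLaw_expMeasure {X : Ω → ℝ} {r : ℝ} (hX : HasLaw X (expMeasure r) P)
    (hr : 0 < r) : ∀ᵐ ω ∂P, 0 < X ω :=
  ae_of_ae_map hX.aemeasurable (hX.map_eq ▸ ae_pos_expMeasure hr)

theorem ae_tendsto_sum_range_atTop_of_expMeasure [IsProbabilityMeasure P] {X : ℕ → Ω → ℝ} {r : ℝ}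
    (hX : iIndepFun X P) (hlaw : ∀ k, HasLaw (X k) (expMeasure r) P) (hr : 0 < r) :
    ∀ᵐ ω ∂P, Tendsto (fun n => ∑ i ∈ Finset.range n, X i ω) atTop atTop :=
  ae_tendsto_sum_range_atTop_of_pos (fun _ _ hij => hX.indepFun hij)
    (fun k => (hlaw k).identDistrib (hlaw 0)) (ae_pos_of_hasLaw_expMeasure (hlaw 0) hr)

/-- The product `∏_{k < m} g(T_k, y_k)` over the first `m` points `T_k = baseArrival σ k` with their
marks `y_k`. As `m → ∞` it becomes the multiplicative functional of Campbell's formula. -/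
def markedProd (g : ℝ → ℝ → ℂ) (σ y : ℕ → ℝ) (m : ℕ) : ℂ :=
  ∏ k ∈ Finset.range m, g (baseArrival σ k) (y k)

variable {g : ℝ → ℝ → ℂ} {c : ℝ → ℂ}

theorem measurable_markedProd (hg : Measurable (Function.uncurry g)) (m : ℕ) :
    Measurable fun p : (ℕ → ℝ) × (ℕ → ℝ) => markedProd g p.1 p.2 m := by
  refine Finset.measurable_fun_prod _ fun k _ => hg.comp (f := fun p : (ℕ → ℝ) × (ℕ → ℝ) =>
    (baseArrival p.1 k, p.2 k)) ?_
  unfold baseArrival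
  fun_prop

theorem aemeasurable_markedProd (hg : Measurable (Function.uncurry g)) {σ z : ℕ → Ω → ℝ}
    (hσ : ∀ k, AEMeasurable (σ k) P) (hz : ∀ k, AEMeasurable (z k) P) (m : ℕ) :
    AEMeasurable (fun ω => markedProd g (σ · ω) (z · ω) m) P :=
  (measurable_markedProd hg m).comp_aemeasurable (f := fun ω => (fun k => σ k ω, fun k => z k ω))
    ((aemeasurable_pi_lambda _ hσ).prodMk (aemeasurable_pi_lambda _ hz))

theorem norm_markedProd_le_one (hg1 : ∀ v y, ‖g v y‖ ≤ 1) (σ y : ℕ → ℝ) (m : ℕ) :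
    ‖markedProd g σ y m‖ ≤ 1 := by
  rw [markedProd, norm_prod]
  exact Finset.prod_le_one (fun _ _ => norm_nonneg _) fun _ _ => hg1 _ _

theorem integral_prod_mul_exp_neg_primitive {ν : Measure ℝ} [IsProbabilityMeasure ν]
    (hg : Measurable (Function.uncurry g)) (hg1 : ∀ v y, ‖g v y‖ ≤ 1) (hc : Integrable c)
    (hgc : ∀ v, ∫ y, g v y ∂ν = 1 + c v) (u : ℝ) :
    ∫ w, g (u + w.1) w.2 * Complex.exp (-∫ r in 0..(u + w.1), c r) ∂(expMeasure 1).prod ν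
      = Complex.exp (-∫ r in 0..u, c r) := by
  have := isProbabilityMeasure_expMeasure one_pos
  have hc1 (v : ℝ) : ‖1 + c v‖ ≤ 1 := by
    rw [← hgc]
    simpa using norm_integral_le_of_norm_le_const (μ := ν) (.of_forall (hg1 v))
  have G_measurable := (continuous_exp_neg_primitive hc).measurable
  rw [integral_prod, ← integral_expMeasure_mul_exp_neg_primitive hc hc1]
  · simp only [integral_mul_const, hgc]
  · refine .of_bound (C := 1 * Real.exp (∫ r, ‖c r‖)) ?_ (.of_forall fun w => ?_)
    · exact ((hg.comp (f := fun w : ℝ × ℝ => (u + w.1, w.2)) (by fun_prop)).mul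
        (G_measurable.comp (by fun_prop))).aestronglyMeasurable
    · rw [norm_mul]
      gcongr
      exacts [hg1 _ _, norm_exp_neg_primitive_le hc _]

variable {σ z : ℕ → Ω → ℝ} {ν : Measure ℝ}

theorem indepFun_markedProd_prodMk (hσz : iIndepFun (Sum.elim σ z) P)
    (hσ : ∀ k, AEMeasurable (σ k) P) (hz : ∀ k, AEMeasurable (z k) P)
    (hg : Measurable (Function.uncurry g)) (m : ℕ) :
    IndepFun (fun ω => (∑ i ∈ Finset.range m, σ i ω, markedProd g (σ · ω) (z · ω) m))
      (fun ω => (σ m ω, z m ω)) P := by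
  refine indepFun_of_dependsOn hσz (by rintro (i | i) <;> simp [hσ, hz])
    (A := (Finset.range m).disjSum (Finset.range m)) (B := {.inl m, .inr m}) (by simp)
    (φ := fun w => (∑ i ∈ Finset.range m, w (.inl i),
      markedProd g (fun i => w (.inl i)) (fun i => w (.inr i)) m))
    (ψ := fun w => (w (.inl m), w (.inr m))) ?_ (by fun_prop) (fun w w' h => ?_) fun w w' h => ?_
  · exact (by fun_prop : Measurable _).prodMk ((measurable_markedProd hg m).comp
      (f := fun w : ℕ ⊕ ℕ → ℝ => (fun i => w (.inl i), fun i => w (.inr i))) (by fun_prop))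
  · have hl : ∀ i < m, w (.inl i) = w' (.inl i) := fun i hi => h _ (by simpa using hi)
    have hr : ∀ i < m, w (.inr i) = w' (.inr i) := fun i hi => h _ (by simpa using hi)
    refine Prod.ext (Finset.sum_congr rfl fun i hi => hl i (Finset.mem_range.1 hi)) ?_
    simp only [markedProd]
    refine Finset.prod_congr rfl fun k hk => ?_
    have hk := Finset.mem_range.1 hk
    congr 1
    · exact Finset.sum_congr rfl fun i hi => hl i (by have := Finset.mem_range.1 hi; lia)
    · exact hr k hk
  · simp [h]

variable [IsProbabilityMeasure P] [IsProbabilityMeasure ν]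

theorem integral_markedProd_mul_exp_neg_primitive (hσz : iIndepFun (Sum.elim σ z) P)
    (hσ : ∀ k, HasLaw (σ k) (expMeasure 1) P) (hz : ∀ k, HasLaw (z k) ν P)
    (hg : Measurable (Function.uncurry g)) (hg1 : ∀ v y, ‖g v y‖ ≤ 1) (hc : Integrable c)
    (hgc : ∀ v, ∫ y, g v y ∂ν = 1 + c v) (m : ℕ) :
    ∫ ω, markedProd g (σ · ω) (z · ω) m *
      Complex.exp (-∫ r in 0..∑ i ∈ Finset.range m, σ i ω, c r) ∂P = 1 := by
  induction m with
  | zero => simp [markedProd]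
  | succ m ih =>
    have := isProbabilityMeasure_expMeasure one_pos
    let Φ : (ℝ × ℂ) × (ℝ × ℝ) → ℂ := fun p =>
      p.1.2 * (g (p.1.1 + p.2.1) p.2.2 * Complex.exp (-∫ r in 0..(p.1.1 + p.2.1), c r))
    have G_measurable := (continuous_exp_neg_primitive hc).measurable
    have Φ_measurable : Measurable Φ :=
      (by fun_prop : Measurable fun p : (ℝ × ℂ) × (ℝ × ℝ) => p.1.2).mul
        ((hg.comp (f := fun p : (ℝ × ℂ) × (ℝ × ℝ) => (p.1.1 + p.2.1, p.2.2)) (by fun_prop)).mul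
          (G_measurable.comp (by fun_prop)))
    have past_aemeasurable : AEMeasurable
        (fun ω => (∑ i ∈ Finset.range m, σ i ω, markedProd g (σ · ω) (z · ω) m)) P :=
      (Finset.aemeasurable_fun_sum _ fun i _ => (hσ i).aemeasurable).prodMk
        (aemeasurable_markedProd hg (fun k => (hσ k).aemeasurable) (fun k => (hz k).aemeasurable) m)
    have law_new : HasLaw (fun ω => (σ m ω, z m ω)) ((expMeasure 1).prod ν) P :=
      (hσz.indepFun (i := .inl m) (j := .inr m) (by simp)).hasLaw_prod (hσ m) (hz m)
    have Φ_integrable : Integrable (fun ω => Φ ((∑ i ∈ Finset.range m, σ i ω,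
        markedProd g (σ · ω) (z · ω) m), (σ m ω, z m ω))) P := by
      refine .of_bound (C := 1 * (1 * Real.exp (∫ r, ‖c r‖))) (Φ_measurable.comp_aemeasurable
        (past_aemeasurable.prodMk law_new.aemeasurable)).aestronglyMeasurable
        (.of_forall fun ω => ?_)
      simp only [Φ, norm_mul]
      gcongr
      exacts [norm_markedProd_le_one hg1 _ _ _, hg1 _ _, norm_exp_neg_primitive_le hc _]
    have step := integral_comp_prodMk_of_indepFun (Φ := Φ) past_aemeasurable law_new
      (indepFun_markedProd_prodMk hσz (fun k => (hσ k).aemeasurable) (fun k => (hz k).aemeasurable)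
        hg m) Φ_measurable.aestronglyMeasurable Φ_integrable
    simp only [Φ, integral_const_mul, integral_prod_mul_exp_neg_primitive hg hg1 hc hgc, ih] at step
    rw [← step]
    simp only [markedProd, Finset.prod_range_succ, Finset.sum_range_succ, mul_assoc, baseArrival]

theorem integral_of_tendsto_markedProd (hσz : iIndepFun (Sum.elim σ z) P)
    (hσ : ∀ k, HasLaw (σ k) (expMeasure 1) P) (hz : ∀ k, HasLaw (z k) ν P)
    (hg : Measurable (Function.uncurry g)) (hg1 : ∀ v y, ‖g v y‖ ≤ 1) (hc : Integrable c)
    (hgc : ∀ v, ∫ y, g v y ∂ν = 1 + c v) {N : Ω → ℂ}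
    (hN : ∀ᵐ ω ∂P, Tendsto (markedProd g (σ · ω) (z · ω)) atTop (𝓝 (N ω))) :
    ∫ ω, N ω ∂P = Complex.exp (∫ v in Set.Ioi 0, c v) := by
  have times_tendsto := ae_tendsto_sum_range_atTop_of_expMeasure
    (hσz.precomp Sum.inl_injective) hσ one_pos
  have limit : Tendsto (fun m => ∫ ω, markedProd g (σ · ω) (z · ω) m *
      Complex.exp (-∫ r in 0..∑ i ∈ Finset.range m, σ i ω, c r) ∂P) atTop
      (𝓝 (∫ ω, N ω * Complex.exp (-∫ v in Set.Ioi 0, c v) ∂P)) := by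
    refine tendsto_integral_of_dominated_convergence
      (fun _ => 1 * Real.exp (∫ r, ‖c r‖)) (fun m => ?_) (integrable_const _)
      (fun m => .of_forall fun ω => ?_) ?_
    · exact ((aemeasurable_markedProd hg (fun k => (hσ k).aemeasurable)
        (fun k => (hz k).aemeasurable) m).mul
        ((continuous_exp_neg_primitive hc).measurable.comp_aemeasurable
          (Finset.aemeasurable_fun_sum _ fun i _ => (hσ i).aemeasurable))).aestronglyMeasurable
    · rw [norm_mul]
      gcongr
      exacts [norm_markedProd_le_one hg1 _ _ _, norm_exp_neg_primitive_le hc _]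
    · filter_upwards [hN, times_tendsto] with ω hNω hω
      exact hNω.mul (Complex.continuous_exp.tendsto _ |>.comp
        (intervalIntegral_tendsto_integral_Ioi 0 hc.integrableOn hω).neg)
  simp only [integral_markedProd_mul_exp_neg_primitive hσz hσ hz hg hg1 hc hgc] at limit
  have := tendsto_nhds_unique limit tendsto_const_nhds
  rwa [integral_mul_const, Complex.exp_neg, mul_inv_eq_one₀ (Complex.exp_ne_zero _)] at this

end Campbell

section PoissonCount

variable {Ω : Type*} [MeasurableSpace Ω] {P : Measure Ω} {σ z : ℕ → Ω → ℝ} {ν : Measure ℝ}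
  {A : Set (ℝ × ℝ)} {L : ℝ}

open scoped Classical in
theorem eventually_markedProd_eq_pow_ncard (hA : ∀ p ∈ A, p.1 ≤ L) (s : ℂ) {σ y : ℕ → ℝ}
    (hσ : Tendsto (fun m => ∑ i ∈ Finset.range m, σ i) atTop atTop) :
    ∀ᶠ m in atTop, markedProd (fun v y => if (v, y) ∈ A then s else 1) σ y m
      = s ^ {k | (baseArrival σ k, y k) ∈ A}.ncard := by
  obtain ⟨K, hK⟩ := eventually_atTop.1
    (((tendsto_add_atTop_iff_nat 1).2 hσ).eventually_gt_atTop L)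
  filter_upwards [eventually_ge_atTop K] with m hm
  have counted : {k | (baseArrival σ k, y k) ∈ A}
      = ↑((Finset.range m).filter fun k => (baseArrival σ k, y k) ∈ A) := by
    ext k
    simp only [Finset.coe_filter, Finset.mem_range, Set.mem_ofPred_eq]
    refine ⟨fun h => ⟨?_, h⟩, fun h => h.2⟩
    by_contra! hmk
    exact (hA _ h).not_gt (hK k (hm.trans hmk))
  rw [counted, Set.ncard_coe_finset, markedProd, Finset.prod_ite]
  simp

theorem aemeasurable_ncard_marks (hA : MeasurableSet A) (hσ : ∀ k, AEMeasurable (σ k) P)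
    (hz : ∀ k, AEMeasurable (z k) P) :
    AEMeasurable (fun ω => ({k | (baseArrival (σ · ω) k, z k ω) ∈ A}.ncard : ℝ)) P := by
  have count : Measurable fun p : (ℕ → ℝ) × (ℕ → ℝ) =>
      ({k | (baseArrival p.1 k, p.2 k) ∈ A}.ncard : ℝ) := by
    refine measurable_from_top.comp (measurable_ncard.comp (measurable_set_iff.2 fun k => ?_))
    have mark : Measurable fun p : (ℕ → ℝ) × (ℕ → ℝ) => (baseArrival p.1 k, p.2 k) := by
      unfold baseArrival
      fun_prop
    exact hA.mem.comp mark
  exact count.comp_aemeasurable (f := fun ω => (fun k => σ k ω, fun k => z k ω))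
    ((aemeasurable_pi_lambda _ hσ).prodMk (aemeasurable_pi_lambda _ hz))

variable [IsProbabilityMeasure P] [IsProbabilityMeasure ν]

theorem integrable_measureReal_section (hA : MeasurableSet A) (hAL : A ⊆ Set.Ioc 0 L ×ˢ Set.univ) :
    Integrable fun v => ν.real (Prod.mk v ⁻¹' A) := by
  have vanish : ∀ v ∉ Set.Ioc 0 L, ν.real (Prod.mk v ⁻¹' A) = 0 := fun v hv => by
    rw [show Prod.mk v ⁻¹' A = ∅ from Set.eq_empty_of_forall_notMem fun y hy => hv (hAL hy).1,
      measureReal_empty]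
  rw [← integrableOn_iff_integrable_of_support_subset (s := Set.Ioc 0 L)
    fun v hv => by_contra fun h => hv (vanish v h)]
  exact Measure.integrableOn_of_bounded (M := 1) measure_Ioc_lt_top.ne
    (measurable_measure_prodMk_left hA).ennreal_toReal.aestronglyMeasurable
    (.of_forall fun v => (Real.norm_of_nonneg measureReal_nonneg).trans_le measureReal_le_one)

open scoped Classical in
theorem integral_pow_ncard_marks (hσz : iIndepFun (Sum.elim σ z) P)
    (hσ : ∀ k, HasLaw (σ k) (expMeasure 1) P) (hz : ∀ k, HasLaw (z k) ν P)
    (hA : MeasurableSet A) (hAL : A ⊆ Set.Ioc 0 L ×ˢ Set.univ) {s : ℂ} (hs : ‖s‖ ≤ 1) :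
    ∫ ω, s ^ {k | (baseArrival (σ · ω) k, z k ω) ∈ A}.ncard ∂P
      = Complex.exp ((s - 1) * (∫ v in Set.Ioi 0, ν.real (Prod.mk v ⁻¹' A) : ℝ)) := by
  have hgc (v : ℝ) : ∫ y, (if (v, y) ∈ A then s else 1) ∂ν
      = 1 + (s - 1) * (ν.real (Prod.mk v ⁻¹' A) : ℂ) := by
    have split (y : ℝ) : (if (v, y) ∈ A then s else 1)
        = 1 + (Prod.mk v ⁻¹' A).indicator (fun _ => s - 1) y := by
      by_cases h : (v, y) ∈ A <;> simp [h]
    have section_measurable : MeasurableSet (Prod.mk v ⁻¹' A) := measurable_prodMk_left hA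
    simp only [split]
    rw [integral_add (integrable_const _) ((integrable_const _).indicator section_measurable),
      integral_indicator_const _ section_measurable]
    simp [mul_comm]
  have hc : Integrable fun v => (s - 1) * (ν.real (Prod.mk v ⁻¹' A) : ℂ) :=
    (integrable_measureReal_section hA hAL).ofReal.const_mul (s - 1)
  rw [integral_of_tendsto_markedProd hσz hσ hz (g := fun v y => if (v, y) ∈ A then s else 1)
    (Measurable.ite hA measurable_const measurable_const)
    (fun v y => by split_ifs <;> simp [hs]) hc hgc]
  · rw [integral_const_mul, integral_complex_ofReal]
  · filter_upwards [ae_tendsto_sum_range_atTop_of_expMeasure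
      (hσz.precomp Sum.inl_injective) hσ one_pos] with ω hω
    exact tendsto_const_nhds.congr' ((eventually_markedProd_eq_pow_ncard
      (fun p hp => (hAL hp).1.2) s hω).mono fun m hm => hm.symm)

theorem hasLaw_ncard_marks (hσz : iIndepFun (Sum.elim σ z) P)
    (hσ : ∀ k, HasLaw (σ k) (expMeasure 1) P) (hz : ∀ k, HasLaw (z k) ν P)
    (hA : MeasurableSet A) (hAL : A ⊆ Set.Ioc 0 L ×ˢ Set.univ) :
    HasLaw (fun ω => ({k | (baseArrival (σ · ω) k, z k ω) ∈ A}.ncard : ℝ))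
      ((poissonMeasure (∫ v in Set.Ioi 0, ν.real (Prod.mk v ⁻¹' A)).toNNReal).map Nat.cast) P := by
  have count_aemeasurable := aemeasurable_ncard_marks hA (fun k => (hσ k).aemeasurable)
    fun k => (hz k).aemeasurable
  refine ⟨count_aemeasurable, ?_⟩
  have := Measure.isProbabilityMeasure_map count_aemeasurable
  refine Measure.ext_of_charFun (funext fun θ => ?_)
  rw [charFun_map_cast_poissonMeasure, charFun_apply_real,
    integral_map count_aemeasurable (by fun_prop)]
  have char_pow (n : ℕ) : Complex.exp (θ * ((n : ℝ) : ℂ) * Complex.I)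
      = Complex.exp (θ * Complex.I) ^ n := by
    rw [← Complex.exp_nat_mul]
    push_cast
    ring_nf
  simp_rw [char_pow]
  rw [integral_pow_ncard_marks hσz hσ hz hA hAL (Complex.norm_exp_ofReal_mul_I θ).le, mul_comm,
    Real.coe_toNNReal _ (integral_nonneg fun v => measureReal_nonneg)]

end PoissonCount

section QueueLaw

variable {Ω : Type*} [MeasurableSpace Ω] {P : Measure Ω}
  {E : Type*} [Finite E] [MeasurableSpace E] [DiscreteMeasurableSpace E] {σ z : ℕ → Ω → ℝ}

theorem ae_jobsPresent_eq (hσ : ∀ k, HasLaw (σ k) (expMeasure 1) P)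
    (hz : ∀ k, HasLaw (z k) (expMeasure 1) P) (lam kap mu : E → ℝ≥0)
    {f : ℝ≥0 → E} (hf : Measurable f) (t : ℝ≥0) :
    ∀ᵐ ω ∂P, jobsPresent lam kap mu f (σ · ω) (z · ω) t = {k | (baseArrival (σ · ω) k, z k ω) ∈
      {p : ℝ × ℝ | p.1 ∈ Set.Ioc 0 (pathIntegral lam f 0 t) ∧
        markThreshold lam kap mu f t p.1 < p.2}} := by
  filter_upwards [ae_all_iff.2 fun k => ae_pos_of_hasLaw_expMeasure (hσ k) one_pos,
    ae_all_iff.2 fun k => ae_pos_of_hasLaw_expMeasure (hz k) one_pos] with ω hσω hzω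
  ext k
  have arrival_pos : 0 < baseArrival (σ · ω) k :=
    Finset.sum_pos (fun i _ => hσω i) (Finset.nonempty_range_add_one)
  rw [mem_jobsPresent_iff lam kap mu hf t (hzω k)]
  simp [arrival_pos]

theorem hasLaw_numJobs [IsProbabilityMeasure P] (hσz : iIndepFun (Sum.elim σ z) P)
    (hσ : ∀ k, HasLaw (σ k) (expMeasure 1) P) (hz : ∀ k, HasLaw (z k) (expMeasure 1) P)
    (lam kap mu : E → ℝ≥0) {f : ℝ≥0 → E} (hf : Measurable f) (t : ℝ≥0) :
    HasLaw (fun ω => (numJobs lam kap mu f (σ · ω) (z · ω) t : ℝ))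
      ((poissonMeasure (phi lam kap mu t f).toNNReal).map Nat.cast) P := by
  have := isProbabilityMeasure_expMeasure one_pos
  let A := {p : ℝ × ℝ | p.1 ∈ Set.Ioc 0 (pathIntegral lam f 0 t) ∧
    markThreshold lam kap mu f t p.1 < p.2}
  have hA : MeasurableSet A := (measurable_fst measurableSet_Ioc).inter
    (measurableSet_lt ((measurable_markThreshold lam kap mu hf t).comp measurable_fst)
      measurable_snd)
  have mean : ∫ v in Set.Ioi 0, (expMeasure 1).real (Prod.mk v ⁻¹' A) = phi lam kap mu t f := by
    have section_mass : ∀ v, (expMeasure 1).real (Prod.mk v ⁻¹' A)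
        = (Set.Ioc 0 (pathIntegral lam f 0 t)).indicator
          (fun v => Real.exp (-markThreshold lam kap mu f t v)) v := fun v => by
      by_cases hv : v ∈ Set.Ioc 0 (pathIntegral lam f 0 t)
      · rw [Set.indicator_of_mem hv, ← one_mul (markThreshold lam kap mu f t v),
          ← measureReal_Ioi_expMeasure one_pos (markThreshold_nonneg lam kap mu hf hv.2)]
        congr 1
        ext y
        simp only [A, Set.mem_preimage, Set.mem_ofPred_eq, hv, true_and, Set.mem_Ioi]
      · rw [Set.indicator_of_notMem hv, show Prod.mk v ⁻¹' A = ∅ from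
          Set.eq_empty_of_forall_notMem fun y hy => hv hy.1, measureReal_empty]
    simp only [section_mass]
    rw [setIntegral_indicator measurableSet_Ioc, Set.inter_eq_right.2 Set.Ioc_subset_Ioi_self,
      ← intervalIntegral.integral_of_le (pathIntegral_nonneg lam f zero_le),
      integral_exp_neg_markThreshold lam kap mu hf t]
  rw [← mean]
  refine (hasLaw_ncard_marks hσz hσ hz hA fun p hp => ⟨hp.1, trivial⟩).congr ?_
  filter_upwards [ae_jobsPresent_eq hσ hz lam kap mu hf t] with ω hω
  rw [numJobs, hω]
  rfl

end QueueLaw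

/-! ### Large deviations of mixed Poisson laws -/

theorem poissonMeasure_tilt_le (r : ℝ≥0) (θ x : ℝ) :
    poissonMeasure r {k | θ * x ≤ θ * k}
      ≤ ENNReal.ofReal (Real.exp (r * (Real.exp θ - 1) - θ * x)) := by
  have hasSum_tilt : HasSum
      (fun k : ℕ => Real.exp (-r) * r ^ k / k.factorial * Real.exp (1 * (θ * k)))
      (Real.exp (r * (Real.exp θ - 1))) := by
    have series := (NormedSpace.expSeries_div_hasSum_exp (r * Real.exp θ : ℝ)).mul_left
      (Real.exp (-r))
    rw [← Real.exp_eq_exp_ℝ, ← Real.exp_add] at series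
    rw [mul_sub_one, sub_eq_neg_add]
    refine series.congr_fun fun k => ?_
    rw [one_mul, mul_comm θ, Real.exp_nat_mul, mul_pow]
    ring
  have integrable_tilt : Integrable (fun k : ℕ => Real.exp (1 * (θ * k))) (poissonMeasure r) :=
    integrable_poissonMeasure_iff.2 (by simpa using hasSum_tilt.summable)
  have mgf_tilt : mgf (fun k : ℕ => θ * (k : ℝ)) (poissonMeasure r) 1
      = Real.exp (r * (Real.exp θ - 1)) :=
    (integral_poissonMeasure r _).trans hasSum_tilt.tsum_eq
  rw [← ofReal_measureReal]
  refine ENNReal.ofReal_le_ofReal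
    ((measure_ge_le_exp_mul_mgf (θ * x) zero_le_one integrable_tilt).trans_eq ?_)
  rw [mgf_tilt, ← Real.exp_add]
  ring_nf

theorem log_factorial_le {k : ℕ} (hk : k ≠ 0) :
    Real.log k.factorial ≤ 1 + Real.log k / 2 + k * Real.log k - k := by
  obtain ⟨m, rfl⟩ := Nat.exists_eq_succ_of_ne_zero hk
  have log_stirlingSeq_le := Stirling.log_stirlingSeq'_antitone (zero_le (a := m))
  simp only [Function.comp_apply, Nat.succ_eq_add_one, zero_add,
    Stirling.log_stirlingSeq_formula (m + 1), Stirling.log_stirlingSeq_formula 1]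
    at log_stirlingSeq_le
  rw [Real.log_mul two_ne_zero (by positivity), Real.log_div (by positivity) (by positivity),
    Real.log_exp] at log_stirlingSeq_le
  norm_num at log_stirlingSeq_le ⊢
  linarith

theorem exp_le_poissonMeasure_singleton {r : ℝ≥0} (hr : 0 < r) {k : ℕ} (hk : k ≠ 0) :
    ENNReal.ofReal (Real.exp (-(r - k + k * Real.log (k / r) + 1 + Real.log k / 2)))
      ≤ poissonMeasure r {k} := by
  have hr' : (0 : ℝ) < r := hr
  rw [poissonMeasure_singleton]
  refine ENNReal.ofReal_le_ofReal ((Real.le_log_iff_exp_le (by positivity)).1 ?_)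
  rw [Real.log_div (by positivity) hr'.ne', Real.log_div (by positivity) (by positivity),
    Real.log_mul (by positivity) (by positivity), Real.log_exp, Real.log_pow]
  linarith [log_factorial_le hk]

/-- The law of `N / n`, where `N` is a Poisson variable with parameter `n * γ`. It is used for
`0 ≤ γ`; negative parameters are truncated to `0`. -/
noncomputable def scaledPoisson (n : ℕ) (γ : ℝ) : Measure ℝ :=
  (poissonMeasure (n * γ).toNNReal).map fun k : ℕ => (k : ℝ) / n

theorem scaledPoisson_apply (n : ℕ) (γ : ℝ) {B : Set ℝ} (hB : MeasurableSet B) :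
    scaledPoisson n γ B = poissonMeasure (n * γ).toNNReal {k | (k : ℝ) / n ∈ B} :=
  Measure.map_apply measurable_from_top hB

theorem measurable_scaledPoisson (n : ℕ) : Measurable (scaledPoisson n) := by
  refine Measure.measurable_of_measurable_coe _ fun B hB => ?_
  simp_rw [scaledPoisson_apply n _ hB, poissonMeasure,
    Measure.sum_apply _ (MeasurableSet.of_discrete (s := {k : ℕ | (k : ℝ) / n ∈ B})),
    Measure.smul_apply, smul_eq_mul]
  fun_prop

instance (n : ℕ) (γ : ℝ) : IsProbabilityMeasure (scaledPoisson n γ) :=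
  Measure.isProbabilityMeasure_map measurable_from_top.aemeasurable

theorem scaledPoisson_tilt_le {n : ℕ} (hn : 0 < n) {γ : ℝ} (hγ : 0 ≤ γ) (θ a : ℝ) :
    scaledPoisson n γ {x | θ * a ≤ θ * x}
      ≤ ENNReal.ofReal (Real.exp (-(n * (θ * a - γ * (Real.exp θ - 1))))) := by
  have hn' : (0 : ℝ) < n := mod_cast hn
  rw [scaledPoisson_apply n γ (measurableSet_le (by fun_prop) (by fun_prop))]
  convert poissonMeasure_tilt_le (n * γ).toNNReal θ (n * a) using 3
  · ext k
    simp only [Set.mem_ofPred_eq]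
    rw [mul_div_assoc', le_div_iff₀ hn', mul_assoc, mul_comm a]
  · rw [Real.coe_toNNReal _ (by positivity)]
    ring_nf

theorem scaledPoisson_inter_Iic_le {p γ : ℝ} (hp : 0 ≤ p) (hγ : p ≤ γ) {F : Set ℝ}
    (hF : IsClosed F) {c : ℝ≥0} (hc : ∀ a ∈ F, a ≤ p → (c : ℝ≥0∞) < poissonRate p a) {n : ℕ}
    (hn : 0 < n) :
    scaledPoisson n γ (F ∩ Set.Iic p) ≤ ENNReal.ofReal (Real.exp (-(n * c))) := by
  rcases (F ∩ Set.Iic p).eq_empty_or_nonempty with hempty | hne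
  · simp [hempty]
  have bdd : BddAbove (F ∩ Set.Iic p) := ⟨p, fun a ha => ha.2⟩
  obtain ⟨sup_mem, sup_le⟩ := (hF.inter isClosed_Iic).csSup_mem hne bdd
  obtain ⟨θ, hθ, hcθ⟩ := exists_nonpos_coe_lt_tilt hp sup_le (hc _ sup_mem sup_le)
  calc scaledPoisson n γ (F ∩ Set.Iic p)
      ≤ scaledPoisson n γ {x | θ * sSup (F ∩ Set.Iic p) ≤ θ * x} :=
        measure_mono fun x hx => mul_le_mul_of_nonpos_left (le_csSup bdd hx) hθ
    _ ≤ _ := scaledPoisson_tilt_le hn (hp.trans hγ) θ _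
    _ ≤ _ := by
      gcongr
      nlinarith [Real.exp_le_one_iff.2 hθ]

theorem scaledPoisson_inter_Ici_le {q γ : ℝ} (hγ : 0 ≤ γ) (hq : γ ≤ q) {F : Set ℝ}
    (hF : IsClosed F) {c : ℝ≥0} (hc : ∀ a ∈ F, q ≤ a → (c : ℝ≥0∞) < poissonRate q a) {n : ℕ}
    (hn : 0 < n) :
    scaledPoisson n γ (F ∩ Set.Ici q) ≤ ENNReal.ofReal (Real.exp (-(n * c))) := by
  rcases (F ∩ Set.Ici q).eq_empty_or_nonempty with hempty | hne
  · simp [hempty]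
  have bdd : BddBelow (F ∩ Set.Ici q) := ⟨q, fun a ha => ha.2⟩
  obtain ⟨inf_mem, le_inf⟩ := (hF.inter isClosed_Ici).csInf_mem hne bdd
  obtain ⟨θ, hθ, hcθ⟩ := exists_nonneg_coe_lt_tilt (hγ.trans hq) le_inf (hc _ inf_mem le_inf)
  calc scaledPoisson n γ (F ∩ Set.Ici q)
      ≤ scaledPoisson n γ {x | θ * sInf (F ∩ Set.Ici q) ≤ θ * x} :=
        measure_mono fun x hx => mul_le_mul_of_nonneg_left (csInf_le bdd hx) hθ
    _ ≤ _ := scaledPoisson_tilt_le hn hγ θ _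
    _ ≤ _ := by
      gcongr
      nlinarith [Real.one_le_exp hθ]

theorem poissonMeasure_singleton_le_scaledPoisson {n k : ℕ} {γ : ℝ} {G : Set ℝ}
    (hG : (k : ℝ) / n ∈ G) :
    poissonMeasure (n * γ).toNNReal {k} ≤ scaledPoisson n γ G :=
  (measure_mono (t := (fun j : ℕ => (j : ℝ) / n) ⁻¹' G) (Set.singleton_subset_iff.2 hG)).trans
    (Measure.le_map_apply measurable_from_top.aemeasurable G)

theorem tendsto_floor_mul_div {a : ℝ} (ha : 0 ≤ a) :
    Tendsto (fun n : ℕ => (⌊(n : ℝ) * a⌋₊ : ℝ) / n) atTop (𝓝 a) := by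
  simpa only [Function.comp_def, mul_comm] using
    (tendsto_nat_floor_mul_div_atTop ha).comp (tendsto_natCast_atTop_atTop (R := ℝ))

theorem tendsto_log_floor_mul_div {a : ℝ} (ha : 0 < a) :
    Tendsto (fun n : ℕ => Real.log ⌊(n : ℝ) * a⌋₊ / n) atTop (𝓝 0) := by
  have atTop_floor : Tendsto (fun n : ℕ => (⌊(n : ℝ) * a⌋₊ : ℝ)) atTop atTop :=
    tendsto_natCast_atTop_atTop.comp (tendsto_nat_floor_atTop.comp
      (tendsto_natCast_atTop_atTop.atTop_mul_const ha))
  have product := (Real.isLittleO_log_id_atTop.tendsto_div_nhds_zero.comp atTop_floor).mul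
    (tendsto_floor_mul_div ha.le)
  rw [zero_mul] at product
  refine product.congr' ?_
  filter_upwards [atTop_floor.eventually_ne_atTop 0] with n hn
  exact div_mul_div_cancel₀ hn

theorem eventually_exp_le_scaledPoisson_of_pos {γ a L : ℝ} (hγ : 0 < γ) (ha : 0 < a) {G : Set ℝ}
    (hG : G ∈ 𝓝 a) (hL : γ - a + a * Real.log (a / γ) < L) :
    ∀ᶠ x : ℕ × ℝ in atTop ×ˢ 𝓝 γ,
      ENNReal.ofReal (Real.exp (-(x.1 * L))) ≤ scaledPoisson x.1 x.2 G := by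
  let k (n : ℕ) : ℕ := ⌊(n : ℝ) * a⌋₊
  have ratio : Tendsto (fun n : ℕ => (k n : ℝ) / n) atTop (𝓝 a) := tendsto_floor_mul_div ha.le
  have error : Tendsto (fun n : ℕ => 1 / (n : ℝ) + Real.log (k n) / n / 2) atTop (𝓝 0) := by
    simpa using (tendsto_const_div_atTop_nhds_zero_nat (1 : ℝ)).add
      ((tendsto_log_floor_mul_div ha).div_const 2)
  have exponent : Tendsto (fun x : ℕ × ℝ => x.2 - k x.1 / x.1
        + k x.1 / x.1 * Real.log (k x.1 / x.1 / x.2)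
        + (1 / (x.1 : ℝ) + Real.log (k x.1) / x.1 / 2)) (atTop ×ˢ 𝓝 γ)
      (𝓝 (γ - a + a * Real.log (a / γ) + 0)) :=
    have ratio' := ratio.comp (tendsto_fst (g := 𝓝 γ))
    ((tendsto_snd.sub ratio').add (ratio'.mul ((ratio'.div tendsto_snd hγ.ne').log
      (div_pos ha hγ).ne'))).add (error.comp tendsto_fst)
  filter_upwards [exponent.eventually_lt_const (by rwa [add_zero]),
    tendsto_snd.eventually_const_lt hγ, tendsto_fst.eventually (ratio.eventually_mem hG),
    tendsto_fst.eventually (ratio.eventually_const_lt ha),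
    tendsto_fst.eventually (eventually_gt_atTop 0)] with ⟨n, r⟩ hlt hr hkG hk hn
  dsimp only at hlt hr hkG hk hn ⊢
  have hn' : (0 : ℝ) < n := mod_cast hn
  have hk0 : k n ≠ 0 := fun h0 => by simp [h0] at hk
  refine le_trans (ENNReal.ofReal_le_ofReal (Real.exp_le_exp.2 (neg_le_neg ?_)))
    ((exp_le_poissonMeasure_singleton (Real.toNNReal_pos.2 (mul_pos hn' hr)) hk0).trans
      (poissonMeasure_singleton_le_scaledPoisson hkG))
  rw [Real.coe_toNNReal _ (mul_pos hn' hr).le]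
  refine le_of_eq_of_le ?_ (mul_le_mul_of_nonneg_left hlt.le hn'.le)
  field_simp
  ring

theorem eventually_exp_le_scaledPoisson {γ a L : ℝ} (hγ : 0 ≤ γ) {G : Set ℝ} (hG : G ∈ 𝓝 a)
    (hL : poissonRate γ a < ENNReal.ofReal L) :
    ∀ᶠ x : ℕ × ℝ in atTop ×ˢ 𝓝 γ,
      ENNReal.ofReal (Real.exp (-(x.1 * L))) ≤ scaledPoisson x.1 x.2 G := by
  rcases lt_trichotomy a 0 with ha | rfl | ha
  · simp [poissonRate_of_neg ha] at hL
  · have hγL : max γ 0 < L := by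
      rw [max_eq_left hγ]
      simpa [poissonRate, ENNReal.ofReal_lt_ofReal_iff_of_nonneg hγ] using hL
    filter_upwards [(tendsto_snd.max tendsto_const_nhds).eventually_lt_const hγL] with ⟨n, r⟩ hr
    refine le_trans ?_ (poissonMeasure_singleton_le_scaledPoisson (k := 0)
      (by simpa using mem_of_mem_nhds hG))
    rw [poissonMeasure_singleton]
    refine ENNReal.ofReal_le_ofReal ?_
    simp only [pow_zero, mul_one, Nat.factorial_zero, Nat.cast_one, div_one, Real.coe_toNNReal']
    rw [← mul_zero (n : ℝ), ← mul_max_of_nonneg r 0 n.cast_nonneg]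
    gcongr
  · have hγ' : 0 < γ := hγ.lt_of_ne' fun h0 => by simp [poissonRate, h0, ha.not_gt, ha.ne'] at hL
    rw [poissonRate_of_nonneg ha.le hγ'] at hL
    exact eventually_exp_le_scaledPoisson_of_pos hγ' ha hG (ENNReal.ofReal_lt_ofReal_iff'.1 hL).1

section Mixture

variable {ν : Measure ℝ}

/-- The law of `N / n`, where `N` is mixed Poisson: given `γ`, distributed according to `ν`, it is a
Poisson variable with parameter `n * γ`. -/
noncomputable def scaledMixedPoisson (ν : Measure ℝ) (n : ℕ) : Measure ℝ :=
  ν.bind (scaledPoisson n)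

theorem scaledMixedPoisson_apply (n : ℕ) {B : Set ℝ} (hB : MeasurableSet B) :
    scaledMixedPoisson ν n B = ∫⁻ γ, scaledPoisson n γ B ∂ν :=
  Measure.bind_apply hB (measurable_scaledPoisson n).aemeasurable

theorem exists_exp_le_scaledMixedPoisson [IsFiniteMeasure ν] {γ L : ℝ} (hγ : γ ∈ ν.support)
    {G : Set ℝ} (hG : MeasurableSet G) (h : ∀ᶠ x : ℕ × ℝ in atTop ×ˢ 𝓝 γ,
      ENNReal.ofReal (Real.exp (-(x.1 * L))) ≤ scaledPoisson x.1 x.2 G) :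
    ∃ C : ℝ, 0 < C ∧ ∀ᶠ n : ℕ in atTop,
      ENNReal.ofReal (C * Real.exp (-(n * L))) ≤ scaledMixedPoisson ν n G := by
  obtain ⟨p, hp, q, hq, hpq⟩ := eventually_prod_iff.1 h
  obtain ⟨U, hU, hUo, hγU⟩ := eventually_nhds_iff.1 hq
  have hνU : 0 < ν U := (Measure.mem_support_iff_forall γ).1 hγ U (hUo.mem_nhds hγU)
  refine ⟨(ν U).toReal, ENNReal.toReal_pos hνU.ne' (measure_ne_top ν U), hp.mono fun n hn => ?_⟩
  calc ENNReal.ofReal ((ν U).toReal * Real.exp (-(n * L)))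
      = ∫⁻ _ in U, ENNReal.ofReal (Real.exp (-(n * L))) ∂ν := by
        rw [setLIntegral_const, ENNReal.ofReal_mul ENNReal.toReal_nonneg,
          ENNReal.ofReal_toReal (measure_ne_top ν U), mul_comm]
    _ ≤ ∫⁻ r in U, scaledPoisson n r G ∂ν :=
        setLIntegral_mono' hUo.measurableSet fun r hr => hpq hn (hU r hr)
    _ ≤ scaledMixedPoisson ν n G := by
        rw [scaledMixedPoisson_apply n hG]
        exact setLIntegral_le_lintegral U _

variable {p q : ℝ}

theorem scaledPoisson_le_of_lt_mixedPoissonRate {γ : ℝ} (hp : 0 ≤ p) (hγ : γ ∈ Set.Icc p q)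
    {F : Set ℝ} (hF : IsClosed F) {c : ℝ≥0}
    (hc : ∀ a ∈ F, (c : ℝ≥0∞) < mixedPoissonRate (Set.Icc p q) (supportRate (Set.Icc p q)) a)
    {n : ℕ} (hn : 0 < n) :
    scaledPoisson n γ F ≤ ENNReal.ofReal (2 * Real.exp (-(n * c))) := by
  have hpq : p ≤ q := hγ.1.trans hγ.2
  have rate_le : ∀ a ∈ F, a ≤ p → (c : ℝ≥0∞) < poissonRate p a := fun a ha hap => by
    simpa [mixedPoissonRate_supportRate_Icc hp hpq, hap, hap.trans hpq] using hc a ha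
  have rate_ge : ∀ a ∈ F, q ≤ a → (c : ℝ≥0∞) < poissonRate q a := fun a ha haq => by
    simpa [mixedPoissonRate_Icc_of_ge hp hpq haq] using hc a ha
  have cover : F ⊆ F ∩ Set.Iic p ∪ F ∩ Set.Ici q := fun a ha => by
    by_contra! hne
    have hap : p < a := by_contra fun h => hne (.inl ⟨ha, not_lt.1 h⟩)
    have haq : a < q := by_contra fun h => hne (.inr ⟨ha, not_lt.1 h⟩)
    simpa [mixedPoissonRate_Icc_of_mem hp ⟨hap.le, haq.le⟩] using hc a ha
  calc scaledPoisson n γ F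
      ≤ scaledPoisson n γ (F ∩ Set.Iic p) + scaledPoisson n γ (F ∩ Set.Ici q) :=
        (measure_mono cover).trans (measure_union_le _ _)
    _ ≤ ENNReal.ofReal (Real.exp (-(n * c))) + ENNReal.ofReal (Real.exp (-(n * c))) :=
        add_le_add (scaledPoisson_inter_Iic_le hp hγ.1 hF rate_le hn)
          (scaledPoisson_inter_Ici_le (hp.trans hγ.1) hγ.2 hF rate_ge hn)
    _ = ENNReal.ofReal (2 * Real.exp (-(n * c))) := by
        rw [← ENNReal.ofReal_add (by positivity) (by positivity), two_mul]

theorem satisfiesLDP_scaledMixedPoisson [IsProbabilityMeasure ν] (hp : 0 ≤ p) (hpq : p ≤ q)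
    (hν : ν.support = Set.Icc p q) :
    SatisfiesLDP (scaledMixedPoisson ν)
      (mixedPoissonRate (Set.Icc p q) (supportRate (Set.Icc p q))) := by
  have prob (n : ℕ) : IsProbabilityMeasure (scaledMixedPoisson ν n) :=
    isProbabilityMeasure_bind (measurable_scaledPoisson n).aemeasurable
      (.of_forall fun γ => inferInstance)
  refine SatisfiesLDP.of_exp_bounds (fun n s => prob_le_one)
    (lowerSemicontinuous_mixedPoissonRate_Icc hp hpq)
    (fun F hF c hc => ⟨2, two_pos, (eventually_gt_atTop 0).mono fun n hn => ?_⟩)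
    (fun G hG a ha hfin ε hε => ?_)
  · have mem_Icc : ∀ᵐ γ ∂ν, γ ∈ Set.Icc p q := hν ▸ Measure.support_mem_ae
    calc scaledMixedPoisson ν n F = ∫⁻ γ, scaledPoisson n γ F ∂ν :=
          scaledMixedPoisson_apply n hF.measurableSet
      _ ≤ ∫⁻ _, ENNReal.ofReal (2 * Real.exp (-(n * c))) ∂ν := lintegral_mono_ae <|
          mem_Icc.mono fun γ hγ => scaledPoisson_le_of_lt_mixedPoissonRate hp hγ hF hc hn
      _ = ENNReal.ofReal (2 * Real.exp (-(n * c))) := by simp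
  · have γ_mem : max p (min q a) ∈ ν.support := by simp [hν, hpq]
    rw [mixedPoissonRate_supportRate_Icc hp hpq] at hfin ⊢
    refine exists_exp_le_scaledMixedPoisson γ_mem hG.measurableSet
      (eventually_exp_le_scaledPoisson (hp.trans (le_max_left p _)) (hG.mem_nhds ha) ?_)
    rw [ENNReal.lt_ofReal_iff_toReal_lt hfin]
    exact lt_add_of_pos_right _ hε

end Mixture

/-! ### The number of jobs in the modulated queue -/

theorem map_comp_prodMk_of_indepFun {Ω S D Y : Type*} [MeasurableSpace Ω] [MeasurableSpace S]
    [MeasurableSpace D] [MeasurableSpace Y] {P : Measure Ω} [IsFiniteMeasure P] {X : Ω → S}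
    {W : Ω → D} (hX : AEMeasurable X P) (hW : AEMeasurable W P) (hXW : IndepFun X W P)
    {N : S × D → Y} (hN : Measurable N) {κ : S → Measure Y} (hκ : Measurable κ)
    (hlaw : ∀ x, P.map (fun ω => N (x, W ω)) = κ x) :
    P.map (fun ω => N (X ω, W ω)) = (P.map X).bind κ := by
  ext B hB
  have pair : P.map (fun ω => N (X ω, W ω)) = ((P.map X).prod (P.map W)).map N := by
    rw [← (indepFun_iff_map_prod_eq_prod_map_map hX hW).1 hXW,
      AEMeasurable.map_map_of_aemeasurable hN.aemeasurable (hX.prodMk hW)]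
    rfl
  rw [pair, Measure.map_apply hN hB, Measure.prod_apply (hN hB),
    Measure.bind_apply hB hκ.aemeasurable]
  refine lintegral_congr fun x => ?_
  have hNx : Measurable fun w => N (x, w) := hN.comp measurable_prodMk_left
  have hNW : AEMeasurable (fun ω => N (x, W ω)) P := hNx.comp_aemeasurable hW
  rw [← hlaw x, Measure.map_apply_of_aemeasurable hNW hB,
    Measure.map_apply_of_aemeasurable hW (measurable_prodMk_left (hN hB))]
  rfl

/-- The space of càdlàg paths, with the σ-algebra generated by the evaluation maps. -/
abbrev CadlagPath (E : Type*) [TopologicalSpace E] : Type _ := {f : ℝ≥0 → E // IsCadlagPath f}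

section CadlagPath

variable {E : Type*} [TopologicalSpace E] [DiscreteTopology E] [MeasurableSpace E]
  [DiscreteMeasurableSpace E]

theorem measurable_eval_cadlagPath : Measurable fun p : CadlagPath E × ℝ≥0 => p.1.1 p.2 :=
  measurable_uncurry_of_isCadlagPath (J := fun s (f : CadlagPath E) => f.1 s)
    (fun s => (measurable_pi_apply s).comp measurable_subtype_coe) fun f => f.2

theorem measurable_phi_cadlagPath [Finite E] (lam kap mu : E → ℝ≥0) (t : ℝ≥0) :
    Measurable fun f : CadlagPath E => phi lam kap mu t f.1 :=
  measurable_phi (J := fun s (f : CadlagPath E) => f.1 s) measurable_eval_cadlagPath lam kap mu t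

end CadlagPath

section Queue

variable {Ω : Type*} [MeasurableSpace Ω] {P : Measure Ω} [IsProbabilityMeasure P]
  {E : Type*} [Finite E] [MeasurableSpace E] [DiscreteMeasurableSpace E] {σ z : ℕ → Ω → ℝ}

theorem map_numJobs_div_eq_scaledPoisson (hσz : iIndepFun (Sum.elim σ z) P)
    (hσ : ∀ k, HasLaw (σ k) (expMeasure 1) P) (hz : ∀ k, HasLaw (z k) (expMeasure 1) P)
    (lam kap mu : E → ℝ≥0) {f : ℝ≥0 → E} (hf : Measurable f) (t : ℝ≥0) (n : ℕ) :
    P.map (fun ω => (numJobs (fun x => (n : ℝ≥0) * lam x) kap mu f (σ · ω) (z · ω) t : ℝ) / n)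
      = scaledPoisson n (phi lam kap mu t f) := by
  have law := hasLaw_numJobs hσz hσ hz (fun x => (n : ℝ≥0) * lam x) kap mu hf t
  have hdiv : Measurable fun x : ℝ => x / n := by fun_prop
  rw [phi_const_mul, NNReal.coe_natCast] at law
  change P.map ((fun x : ℝ => x / n) ∘ fun ω =>
    (numJobs (fun x => (n : ℝ≥0) * lam x) kap mu f (σ · ω) (z · ω) t : ℝ)) = _
  rw [← AEMeasurable.map_map_of_aemeasurable hdiv.aemeasurable law.aemeasurable, law.map_eq,
    Measure.map_map hdiv measurable_from_top]
  rfl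

variable [TopologicalSpace E] [DiscreteTopology E] {J : ℝ≥0 → Ω → E}

theorem IsQueueDriver.map_numJobs_div (h : IsQueueDriver P J σ z) (hm : ∀ s, Measurable (J s))
    (hc : ∀ ω, IsCadlagPath fun s => J s ω) (lam kap mu : E → ℝ≥0) (t : ℝ≥0) (n : ℕ) :
    P.map (fun ω => (numJobs (fun x => (n : ℝ≥0) * lam x) kap mu (fun s => J s ω) (σ · ω) (z · ω) t
        : ℝ) / n)
      = scaledMixedPoisson (P.map fun ω => phi lam kap mu t fun s => J s ω) n := by
  let path (ω : Ω) : CadlagPath E := ⟨fun s => J s ω, hc ω⟩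
  have hpath : Measurable path := (measurable_pi_lambda _ hm).subtype_mk
  have hdrive : AEMeasurable (fun ω => ((σ · ω), (z · ω))) P :=
    (aemeasurable_pi_lambda _ fun k => (h.law_interarrival k).aemeasurable).prodMk
      (aemeasurable_pi_lambda _ fun k => (h.law_mark k).aemeasurable)
  have indep : IndepFun path (fun ω => ((σ · ω), (z · ω))) P := by
    have := h.indep_background
    rw [IndepFun_iff_Indep] at this ⊢
    convert this using 1
    exact MeasurableSpace.comap_comp
  have hphi := measurable_phi_cadlagPath lam kap mu t
  have map_phi : (P.map path).map (fun f => phi lam kap mu t f.1)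
      = P.map fun ω => phi lam kap mu t fun s => J s ω := Measure.map_map hphi hpath
  have hN : Measurable fun x : CadlagPath E × ((ℕ → ℝ) × (ℕ → ℝ)) =>
      (numJobs (fun x => (n : ℝ≥0) * lam x) kap mu x.1.1 x.2.1 x.2.2 t : ℝ) / n :=
    (measurable_from_top.comp (measurable_numJobs_uncurry
      (J := fun s (f : CadlagPath E) => f.1 s) measurable_eval_cadlagPath _ kap mu t)).div_const _
  have mixture := map_comp_prodMk_of_indepFun hpath.aemeasurable hdrive indep hN
    ((measurable_scaledPoisson n).comp hphi) fun f =>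
      map_numJobs_div_eq_scaledPoisson h.indep_driver h.law_interarrival h.law_mark lam kap mu
        f.2.measurable t n
  rw [scaledMixedPoisson, Measure.bind, ← map_phi,
    Measure.map_map (measurable_scaledPoisson n) hphi]
  exact mixture

end Queue

theorem exists_isGLB_isLUB_phi {E : Type*} [Finite E] [Nonempty E] [TopologicalSpace E]
    (lam kap mu : E → ℝ≥0) (t : ℝ≥0) :
    ∃ p q : ℝ, IsGLB (phi lam kap mu t '' {g | IsCadlagPath g}) p ∧
      IsLUB (phi lam kap mu t '' {g | IsCadlagPath g}) q ∧ 0 ≤ p ∧ p ≤ q := by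
  obtain ⟨x⟩ := ‹Nonempty E›
  have const : IsCadlagPath fun _ : ℝ≥0 => x :=
    ⟨fun _ => continuousWithinAt_const, fun _ _ => ⟨x, tendsto_const_nhds⟩⟩
  have nonempty : (phi lam kap mu t '' {g | IsCadlagPath g}).Nonempty := ⟨_, _, const, rfl⟩
  have lower : 0 ∈ lowerBounds (phi lam kap mu t '' {g | IsCadlagPath g}) :=
    Set.forall_mem_image.2 fun g _ => phi_nonneg lam kap mu t g
  obtain ⟨C, hC⟩ := exists_phi_le lam kap mu t
  have hp := isGLB_csInf nonempty ⟨0, lower⟩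
  have hq := isLUB_csSup nonempty ⟨C, Set.forall_mem_image.2 fun g _ => hC g⟩
  exact ⟨_, _, hp, hq, hp.2 lower, isGLB_le_isLUB hp hq nonempty⟩

theorem mainTheorem5_general {Ω : Type*} [MeasurableSpace Ω] (P : Measure Ω)
    [IsProbabilityMeasure P] {E : Type*} [Fintype E] [DecidableEq E] [TopologicalSpace E]
    [DiscreteTopology E] [MeasurableSpace E] [DiscreteMeasurableSpace E]
    (Q : Matrix E E ℝ) (hQ : IsGeneratorMatrix Q) (hirr : IsIrreducibleGenerator Q)
    (J : ℝ≥0 → Ω → E) (hJ : IsMarkovChain P Q J)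
    (σ z : ℕ → Ω → ℝ) (hdrive : IsQueueDriver P J σ z)
    (lam kap mu : E → ℝ≥0) (t : ℝ≥0) :
    ∃ aMinus aPlus : ℝ,
      IsGLB (phi lam kap mu t '' {g | IsCadlagPath g}) aMinus ∧
      IsLUB (phi lam kap mu t '' {g | IsCadlagPath g}) aPlus ∧
      0 ≤ aMinus ∧ aMinus ≤ aPlus ∧
      attainableSet (fun _ => P.map fun ω => phi lam kap mu t fun s => J s ω)
        = Set.Icc aMinus aPlus ∧
      ∃ ψ I : ℝ → ℝ≥0∞,
        SatisfiesLDP (fun _ => P.map fun ω => phi lam kap mu t fun s => J s ω) ψ ∧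
        I = mixedPoissonRate
          (attainableSet (fun _ => P.map fun ω => phi lam kap mu t fun s => J s ω)) ψ ∧
        SatisfiesLDP
          (fun n : ℕ => P.map fun ω =>
            (numJobs (fun x => (n : ℝ≥0) * lam x) kap mu (fun s => J s ω)
              (fun k => σ k ω) (fun k => z k ω) t : ℝ) / n) I ∧
        (∀ a, a < 0 → I a = ⊤) ∧
        (∀ a ∈ Set.Icc 0 aMinus, I a = poissonRate aMinus a) ∧
        (∀ a ∈ Set.Icc aMinus aPlus, I a = 0) ∧
        (∀ a, aPlus ≤ a → I a = poissonRate aPlus a) := by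
  obtain ⟨ω⟩ := nonempty_of_isProbabilityMeasure P
  have : Nonempty E := ⟨J 0 ω⟩
  obtain ⟨p, q, hp, hq, hp0, hpq⟩ := exists_isGLB_isLUB_phi lam kap mu t
  have prob : IsProbabilityMeasure (P.map fun ω => phi lam kap mu t fun s => J s ω) :=
    Measure.isProbabilityMeasure_map (measurable_phi (measurable_uncurry_of_isCadlagPath
      hJ.measurable hJ.cadlag) lam kap mu t).aemeasurable
  have support_phi := hJ.support_map_phi hQ hirr lam kap mu t hp hq
  have attainable : attainableSet (fun _ => P.map fun ω => phi lam kap mu t fun s => J s ω)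
      = Set.Icc p q := by
    rw [attainableSet_const, support_phi, Set.inter_eq_right]
    exact fun γ hγ => hp0.trans hγ.1
  have ldp_phi := satisfiesLDP_const (P.map fun ω => phi lam kap mu t fun s => J s ω)
  rw [support_phi] at ldp_phi
  have ldp_numJobs := satisfiesLDP_scaledMixedPoisson hp0 hpq support_phi
  rw [← funext (hdrive.map_numJobs_div hJ.measurable hJ.cadlag lam kap mu t)] at ldp_numJobs
  exact ⟨p, q, hp, hq, hp0, hpq, attainable, supportRate (Set.Icc p q),
    mixedPoissonRate (Set.Icc p q) (supportRate (Set.Icc p q)), ldp_phi, by rw [attainable],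
    ldp_numJobs, fun _ => mixedPoissonRate_Icc_of_neg, fun _ => mixedPoissonRate_Icc_of_le hpq,
    fun _ => mixedPoissonRate_Icc_of_mem hp0, fun _ => mixedPoissonRate_Icc_of_ge hp0 hpq⟩

theorem mainTheorem5 {Ω : Type*} [MeasurableSpace Ω] (P : Measure Ω) [IsProbabilityMeasure P]
    {d : ℕ} (Q : Matrix (Fin d) (Fin d) ℝ) (hQ : IsGeneratorMatrix Q)
    (hirr : IsIrreducibleGenerator Q)
    (J : ℝ≥0 → Ω → Fin d) (hJ : IsMarkovChain P Q J)
    (σ z : ℕ → Ω → ℝ) (hdrive : IsQueueDriver P J σ z)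
    (lam kap mu : Fin d → ℝ≥0) (t : ℝ≥0) :
    ∃ aMinus aPlus : ℝ,
      IsGLB (phi lam kap mu t '' {g | IsCadlagPath g}) aMinus ∧
      IsLUB (phi lam kap mu t '' {g | IsCadlagPath g}) aPlus ∧
      0 ≤ aMinus ∧ aMinus ≤ aPlus ∧
      -- the background process is not scaled, so the laws of the normalized parameter are constant
      attainableSet (fun _ => P.map fun ω => phi lam kap mu t fun s => J s ω)
        = Set.Icc aMinus aPlus ∧
      ∃ ψ I : ℝ → ℝ≥0∞,
        SatisfiesLDP (fun _ => P.map fun ω => phi lam kap mu t fun s => J s ω) ψ ∧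
        I = mixedPoissonRate
          (attainableSet (fun _ => P.map fun ω => phi lam kap mu t fun s => J s ω)) ψ ∧
        SatisfiesLDP
          (fun n : ℕ => P.map fun ω =>
            (numJobs (fun x => (n : ℝ≥0) * lam x) kap mu (fun s => J s ω)
              (fun k => σ k ω) (fun k => z k ω) t : ℝ) / n) I ∧
        (∀ a, a < 0 → I a = ⊤) ∧
        (∀ a ∈ Set.Icc 0 aMinus, I a = poissonRate aMinus a) ∧
        (∀ a ∈ Set.Icc aMinus aPlus, I a = 0) ∧
        (∀ a, aPlus ≤ a → I a = poissonRate aPlus a) := by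
  exact mainTheorem5_general P Q hQ hirr J hJ σ z hdrive lam kap mu t
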